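/- **The $L^q$ spectrum.** For a Borel probability measure $\nu$ on $\mathbb R^2$ with compact support, $q\in\mathbb R$ and $\delta>0$, let $T_\delta(\nu,q)$ be the supremum of $\sum_i \nu(B(x_i,\delta))^q$ over all families of pairwise disjoint closed balls $B(x_i,\delta)$ with centres $x_i\in\operatorname{supp}\nu$, and let $$T(\nu,q)=\lim_{\delta\to0}\frac{\log T_\delta(\nu,q)}{-\log\delta}$$ whenever the limit exists. **The carpet.** Let $$f_1(x,y)=\Big(\frac x2,\frac y4\Big),\qquad f_2(x,y)=\Big(\frac x4+\frac34,\frac y2+\frac12\Big),$$ let $u\in[\frac12,1)$, $\boldsymbol\mu=(\mu(1),\mu(2))=(u,1-u)$, and let $\nu_{\boldsymbol\mu}$ be the associated self-affine measure, that is, the push-forward of the Bernoulli measure $\boldsymbol\mu^{\mathbb N}$ on $\{1,2\}^{\mathbb N}$ under $(i_1,i_2,\dots)\mapsto\lim_k f_{i_1}\circ\cdots\circ f_{i_k}(0)$ (equivalently, the unique Borel probability measure with $\nu_{\boldsymbol\mu}=u\,\nu_{\boldsymbol\mu}\circ f_1^{-1}+(1-u)\,\nu_{\boldsymbol\mu}\circ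 f_2^{-1}$). **The closed form exponents.** Write $\lambda_i^{(n)}$ for the $n$-th diagonal entry of the linear part of $f_i$, so $\lambda_1^{(1)}=\lambda_2^{(2)}=\frac12$ and $\lambda_1^{(2)}=\lambda_2^{(1)}=\frac14$. For an ordering $\tau=(\tau_1,\tau_2)$ of the coordinates let $T_0^\tau(q)=0$ and define $T_1^\tau(q),T_2^\tau(q)$ recursively as the unique solutions of $$\sum_{i=1}^{2}\mu(i)^q\prod_{\ell=1}^n\big(\lambda_i^{(\tau_\ell)}\big)^{T_\ell^\tau(q)-T_{\ell-1}^\tau(q)}=1\qquad(n=1,2).$$ Let $\sigma=(1,2)$ and $\omega=(2,1)$. Let $s$ be the unique solution of $(1/2)^s+(1/4)^s=1$, so that $2^{-s}=(\sqrt5-1)/2$, and write $$\hat q=\frac{\log 2}{\log\frac{1-u}{u^2}}.$$ **Proposition.** For both $\tau\in\{\sigma,\omega\}$ and every $q\in\mathbb R$ the numbers $T_1^\tau(q)$ and $T_2^\tau(q)$ exist, are unique and coincide. Their common values $T_u^\sigma(q)$ and $T_u^\omega(q)$ are $$T_u^\sigma(q)=\frac{-1}{\log2}\left(q\log\frac{u}{1-u}+\log\left(\frac12\sqrt{1+4\Big(\frac{1-u}{u^2}\Big)^q}-\frac12\right)\right),\qquad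 T_u^\omega(q)=T_{1-u}^\sigma(q),$$ where $T_{1-u}^\sigma(q)$ denotes the same expression with $u$ replaced by $1-u$. The limit $T(\nu_{\boldsymbol\mu},q)$ exists for every $q\in\mathbb R$, and: * if $u\in[\frac12,2^{-s})$, then $$T(\nu_{\boldsymbol\mu},q)=\begin{cases}T_u^\omega(q)&\text{if }q\le0,\\ T_u^\sigma(q)&\text{if }0<q\le\hat q,\\ \frac23+\frac{\log(u(1-u))}{3\log2}\,q&\text{if }q>\hat q.\end{cases}$$ Moreover, $q\mapsto T(\nu_{\boldsymbol\mu},q)$ is differentiable in a neighbourhood of $\hat q$, but it is not twice differentiable at $\hat q$; * if $u\in[2^{-s},1)$, then $$T(\nu_{\boldsymbol\mu},q)=\begin{cases}T_u^\omega(q)&\text{if }q\le0,\\ T_u^\sigma(q)&\text{if }q>0.\end{cases}$$ -/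

import Mathlib

open Set Filter Topology MeasureTheory
open scoped ENNReal

/-! ### The `L^q` spectrum -/

/-- The quantity `T_δ(ν, q)`: the supremum of `∑ i, ν (B (x i, δ)) ^ q` over all centred packings of
the support of `ν`, that is, families of pairwise disjoint closed balls of radius `δ` with centres
in the support. Since the summands are non-negative, finite families suffice. -/
noncomputable def packingSum {X : Type*} [PseudoMetricSpace X] [MeasurableSpace X]
    (ν : Measure X) (q δ : ℝ) : ℝ≥0∞ :=
  ⨆ (s : Finset X) (_ : (s : Set X) ⊆ ν.support)
    (_ : (s : Set X).PairwiseDisjoint fun x => Metric.closedBall x δ),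
    ∑ x ∈ s, ν (Metric.closedBall x δ) ^ q

/-- The `L^q` spectrum of `ν` at `q` exists and equals `t`:
`log (T_δ(ν, q)) / (- log δ)` converges to `t` as `δ → 0+`. The logarithm takes values in the
extended reals (`log 0 = -∞`, `log ∞ = ∞`). -/
def HasLqSpectrum {X : Type*} [PseudoMetricSpace X] [MeasurableSpace X]
    (ν : Measure X) (q t : ℝ) : Prop :=
  Tendsto (fun δ : ℝ => ENNReal.log (packingSum ν q δ) / ((-Real.log δ : ℝ) : EReal))
    (𝓝[>] 0) (𝓝 (t : EReal))

/-! ### Diagonal iterated function systems and their self-affine measures -/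

/-- An iterated function system on `ℝ^d` of `N` affine maps
`x ↦ diag (a i 0, …, a i (d - 1)) x + t i`, given by its coefficients. -/
structure DiagonalIFS (N d : ℕ) where
  /-- the diagonal entries of the linear parts -/
  a : Fin N → Fin d → ℝ
  /-- the translation vectors -/
  t : Fin N → Fin d → ℝ

namespace DiagonalIFS

variable {N d : ℕ} (S : DiagonalIFS N d)

/-- The `i`-th map of the system. -/
noncomputable def map (i : Fin N) (x : EuclideanSpace ℝ (Fin d)) : EuclideanSpace ℝ (Fin d) :=
  WithLp.toLp 2 fun n => S.a i n * x n + S.t i n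

/-- `S.comp w k = f_{w 0} ∘ f_{w 1} ∘ ⋯ ∘ f_{w (k - 1)}`. -/
noncomputable def comp (w : ℕ → Fin N) :
    ℕ → EuclideanSpace ℝ (Fin d) → EuclideanSpace ℝ (Fin d)
  | 0 => id
  | k + 1 => comp w k ∘ S.map (w k)

/-- The natural projection `π(w) = lim_k f_{w 0} ∘ ⋯ ∘ f_{w (k - 1)} (0)`. -/
noncomputable def proj (w : ℕ → Fin N) : EuclideanSpace ℝ (Fin d) :=
  limUnder atTop fun k => S.comp w k 0

/-- The Bernoulli measure on the infinite words over `{0, …, N - 1}` with weights `μ`. -/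
noncomputable def bernoulliMeasure (μ : Fin N → ℝ) : Measure (ℕ → Fin N) :=
  Measure.infinitePi fun _ => ∑ i, ENNReal.ofReal (μ i) • Measure.dirac i

/-- The self-affine measure `ν_μ`: the push-forward of the Bernoulli measure under the natural
projection. -/
noncomputable def selfAffineMeasure (μ : Fin N → ℝ) : Measure (EuclideanSpace ℝ (Fin d)) :=
  (bernoulliMeasure μ).map S.proj

/-! ### The closed form exponents attached to an ordering of the coordinates -/

/-- The maps `f_i` and `f_j` overlap exactly on the subspace spanned by the first `n` coordinate
axes in the ordering `σ`. -/
def OverlapExactly (σ : Equiv.Perm (Fin d)) (n : ℕ) (i j : Fin N) : Prop :=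
  ∀ x : EuclideanSpace ℝ (Fin d), (∀ k, x k ∈ Icc (0 : ℝ) 1) →
    ∀ l : Fin d, (l : ℕ) < n → S.map i x (σ l) = S.map j x (σ l)

open Classical in
/-- The index set `I_n^σ`: the smallest representatives of the classes of maps that overlap exactly
on the subspace spanned by the first `n` coordinate axes in the ordering `σ`. -/
noncomputable def index (σ : Equiv.Perm (Fin d)) (n : ℕ) : Finset (Fin N) :=
  Finset.univ.filter fun j => ∀ i < j, ¬ S.OverlapExactly σ n i j

open Classical in
/-- The projected weights `μ_n^σ (i)`. -/
noncomputable def projWeight (μ : Fin N → ℝ) (σ : Equiv.Perm (Fin d)) (n : ℕ) (i : Fin N) : ℝ :=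
  ∑ j ∈ Finset.univ.filter (fun j => S.OverlapExactly σ n i j), μ j

/-- `T = (T_0, …, T_d)` solves the recursive system of equations which defines the exponents
`T_n^{μ,σ}(q)`: `T_0 = 0` and, for `n = 1, …, d`,
`∑_{i ∈ I_n^σ} μ_n^σ(i)^q ∏_{l=1}^n |a_i^{(σ_l)}|^{T_l - T_{l-1}} = 1`.
(The index `n : Fin d` below stands for the level `n + 1`.) -/
def IsExponentVector (μ : Fin N → ℝ) (σ : Equiv.Perm (Fin d)) (q : ℝ) (T : Fin (d + 1) → ℝ) :
    Prop :=
  T 0 = 0 ∧ ∀ n : Fin d,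
    ∑ i ∈ S.index σ (n + 1), S.projWeight μ σ (n + 1) i ^ q *
      ∏ l ∈ Finset.Iic n, |S.a i (σ l)| ^ (T l.succ - T l.castSucc) = 1

end DiagonalIFS

/-! ### The planar carpet -/

/-- The carpet generated by `f_1 (x, y) = (x / 2, y / 4)` and
`f_2 (x, y) = (x / 4 + 3 / 4, y / 2 + 1 / 2)`. -/
noncomputable def baranskiCarpet : DiagonalIFS 2 2 where
  a := ![![1 / 2, 1 / 4], ![1 / 4, 1 / 2]]
  t := ![![0, 0], ![3 / 4, 1 / 2]]

/-! # The `L^q` spectrum of a planar carpet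

The two maps of the carpet have disjoint images in both coordinate projections. Two points whose
codes agree exactly along a word `w` are therefore at a distance comparable to the longer side
of the rectangle `f_w ([0, 1] ^ 2)`, which is `2 ^ (- depth w)` with
`depth w = min (k + 2 * m) (2 * k + m)`, where `k` and `m` count the letters of `w`
(`dist_carpet_proj_le`, `le_dist_carpet_proj`). So the carpet looks like an ultrametric Cantor set,
a ball of radius about `2 ^ (- L)` is comparable to the cylinder of a word stopped at depth `L`,
and the packing sum is comparable to the partition function
`stopSum A B L = ∑ A ^ k * B ^ m` over the words stopped at depth `L`, with `A = u ^ q` and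
`B = (1 - u) ^ q` (`exists_packingSum_bounds`). It remains to find the exponential growth rate of
`stopSum A B L`, which is symmetric in `A` and `B`; assume `B ≤ A`.

For weights `a + b = 1`, the stopped words form a partition, so `stopSum a b L = 1`. If
`A z + B z ^ 2 = 1`, then `A ^ k B ^ m = z ^ (- depth w) (A z) ^ k (B z ^ 2) ^ m` for words with
`m ≤ k`, and exchanging the letters in the other words only increases the weight; hence
`stopSum A B L ≲ z ^ (- L)` (`stopSum_le`). The closed form exponent is `- log z / log 2`.

* If `B ≤ 2 A ^ 2`, then `B z ^ 2 ≤ A z`, so the Bernoulli weights `(A z, B z ^ 2)` give mass at least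
  one half to the words with `m ≤ k`, by symmetry, and the bound is sharp (`le_stopSum`).
* If `2 A ^ 2 ≤ B`, then comparison with the uniform weights `(1 / 2, 1 / 2)` gives
  `stopSum A B L ≲ (4 A B) ^ (L / 3)` (`stopSum_le_of_critical`). Under the uniform weights the
  imbalance `k - m` of a stopped word has second moment `O (L)`, so the bound is sharp up to a factor
  `exp (O (√L))` (`le_stopSum_of_critical`). This yields the affine part of the spectrum.

For `q ≤ 0` the roles of `u` and `1 - u` are exchanged and only the first case occurs. For `q > 0`
the first case is `((1 - u) / u ^ 2) ^ q ≤ 2`, which holds for all `q` if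
`(1 - u) / u ^ 2 ≤ 1` and means `q ≤ log 2 / log ((1 - u) / u ^ 2)` otherwise. At this threshold the
affine part is the tangent of the closed form exponent, which has a positive second derivative.
-/

/-! ### Stopping words -/

/-- The depth of a word over `{0, 1}` with `k` letters `0` and `m` letters `1`, namely
`k + m + min k m = min (k + 2 * m) (2 * k + m)`: the longer side of the rectangle
`f_w ([0, 1] ^ 2)` has length `2 ^ (- depth w)`. -/
def depth (w : List (Fin 2)) : ℕ :=
  w.count 0 + w.count 1 + min (w.count 0) (w.count 1)

/-- The words whose depth reaches the level `L` with their last letter. Words are stored with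
the last letter first, so that appending a letter is `List.cons`. -/
def stopWords : ℕ → Finset (List (Fin 2))
  | 0 => {[]}
  | L + 1 => (stopWords L).biUnion fun w => if depth w = L then {0 :: w, 1 :: w} else {w}

lemma depth_cons (c : Fin 2) (w : List (Fin 2)) :
    depth w + 1 ≤ depth (c :: w) ∧ depth (c :: w) ≤ depth w + 2 := by
  fin_cases c <;> simp [depth] <;> omega

lemma mem_stopWords {L : ℕ} {w : List (Fin 2)} :
    w ∈ stopWords L ↔ L ≤ depth w ∧ ∀ c t, w = c :: t → depth t < L := by
  induction L generalizing w with
  | zero =>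
    rcases w with _ | ⟨c, t⟩
    · simp [stopWords]
    · simp only [stopWords, Finset.mem_singleton, reduceCtorEq, false_iff, not_and]
      intro _ h
      exact absurd (h c t rfl) (by simp)
  | succ L ih =>
    simp only [stopWords, Finset.mem_biUnion]
    constructor
    · rintro ⟨v, hv, hw⟩
      obtain ⟨h1, h2⟩ := ih.1 hv
      split_ifs at hw with h
      · have : ∃ c, w = c :: v := by
          rcases Finset.mem_insert.1 hw with h | h
          · exact ⟨0, h⟩
          · exact ⟨1, Finset.mem_singleton.1 h⟩
        obtain ⟨c, rfl⟩ := this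
        refine ⟨by have := (depth_cons c v).1; omega, ?_⟩
        rintro c' t ht
        obtain ⟨rfl, rfl⟩ := List.cons.inj ht
        omega
      · obtain rfl := Finset.mem_singleton.1 hw
        exact ⟨by omega, fun c t ht => by have := h2 c t ht; omega⟩
    · rintro ⟨h1, h2⟩
      rcases w with _ | ⟨c, t⟩
      · simp [depth] at h1
      · have ht := h2 c t rfl
        by_cases h : depth t = L
        · refine ⟨t, ih.2 ⟨h.ge, ?_⟩, ?_⟩
          · rintro c' t' rfl
            have := (depth_cons c' t').1
            omega
          · rw [if_pos h]
            fin_cases c <;> simp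
        · refine ⟨c :: t, ih.2 ⟨by omega, ?_⟩, ?_⟩
          · rintro c' t' ht'
            obtain ⟨rfl, rfl⟩ := List.cons.inj ht'
            omega
          · rw [if_neg]
            · simp
            · omega

lemma depth_le_of_mem_stopWords {L : ℕ} {w : List (Fin 2)} (hw : w ∈ stopWords L) :
    L ≤ depth w ∧ depth w ≤ L + 1 := by
  obtain ⟨h1, h2⟩ := mem_stopWords.1 hw
  refine ⟨h1, ?_⟩
  rcases w with _ | ⟨c, t⟩
  · simp [depth]
  · have := h2 c t rfl
    have := (depth_cons c t).2
    omega

lemma sum_stopWords_succ (L : ℕ) (f : List (Fin 2) → ℝ) :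
    ∑ w ∈ stopWords (L + 1), f w =
      ∑ w ∈ stopWords L, if depth w = L then f (0 :: w) + f (1 :: w) else f w := by
  rw [stopWords, Finset.sum_biUnion]
  · refine Finset.sum_congr rfl fun w _ => ?_
    split_ifs
    · rw [Finset.sum_pair (by simp)]
    · simp
  · intro v hv w hw hvw
    rw [Function.onFun, Finset.disjoint_left]
    have hv' := mem_stopWords.1 hv
    have hw' := mem_stopWords.1 hw
    intro x hxv hxw
    split_ifs at hxv hxw with h1 h2 h2
    · simp only [Finset.mem_insert, Finset.mem_singleton] at hxv hxw
      rcases hxv with rfl | rfl <;> rcases hxw with h | h <;> simp_all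
    · obtain rfl := Finset.mem_singleton.1 hxw
      simp only [Finset.mem_insert, Finset.mem_singleton] at hxv
      rcases hxv with h | h <;> have := hw'.2 _ _ h <;> omega
    · obtain rfl := Finset.mem_singleton.1 hxv
      simp only [Finset.mem_insert, Finset.mem_singleton] at hxw
      rcases hxw with h | h <;> have := hv'.2 _ _ h <;> omega
    · exact hvw ((Finset.mem_singleton.1 hxv).symm.trans (Finset.mem_singleton.1 hxw))

/-- Optional stopping for a function that is harmonic on the binary tree. -/
lemma sum_stopWords_of_harmonic (f : List (Fin 2) → ℝ)
    (hf : ∀ w, f (0 :: w) + f (1 :: w) = f w) (L : ℕ) : ∑ w ∈ stopWords L, f w = f [] := by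
  induction L with
  | zero => simp [stopWords]
  | succ L ih =>
    rw [sum_stopWords_succ, ← ih]
    refine Finset.sum_congr rfl fun w _ => ?_
    rw [hf, ite_self]

/-- The product weight `a ^ k * b ^ m` of a word with `k` letters `0` and `m` letters `1`. -/
def wordWeight (a b : ℝ) (w : List (Fin 2)) : ℝ := a ^ w.count 0 * b ^ w.count 1

/-- The partition function of the stopping words at level `L`. -/
def stopSum (a b : ℝ) (L : ℕ) : ℝ := ∑ w ∈ stopWords L, wordWeight a b w

lemma wordWeight_pos {a b : ℝ} (ha : 0 < a) (hb : 0 < b) (w : List (Fin 2)) :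
    0 < wordWeight a b w := by unfold wordWeight; positivity

lemma wordWeight_zero_cons (a b : ℝ) (w : List (Fin 2)) :
    wordWeight a b (0 :: w) = a * wordWeight a b w := by
  simp [wordWeight, pow_succ]; ring

lemma wordWeight_one_cons (a b : ℝ) (w : List (Fin 2)) :
    wordWeight a b (1 :: w) = b * wordWeight a b w := by
  simp [wordWeight, pow_succ]; ring

lemma stopSum_eq_one {a b : ℝ} (hab : a + b = 1) (L : ℕ) : stopSum a b L = 1 := by
  rw [stopSum, sum_stopWords_of_harmonic]
  · simp [wordWeight]
  · intro w
    rw [wordWeight_zero_cons, wordWeight_one_cons, ← add_mul, hab, one_mul]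

/-! ### Exchanging the two letters -/

/-- Exchange of the letters `0` and `1`. -/
def swapWord (w : List (Fin 2)) : List (Fin 2) := w.map (Equiv.swap 0 1)

lemma swapWord_swapWord (w : List (Fin 2)) : swapWord (swapWord w) = w := by
  simp [swapWord, Function.comp_def]

lemma count_zero_swapWord (w : List (Fin 2)) : (swapWord w).count 0 = w.count 1 := by
  have := List.count_map_of_injective w _ (Equiv.swap (0 : Fin 2) 1).injective 1
  simpa [swapWord] using this

lemma count_one_swapWord (w : List (Fin 2)) : (swapWord w).count 1 = w.count 0 := by
  have := List.count_map_of_injective w _ (Equiv.swap (0 : Fin 2) 1).injective 0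
  simpa [swapWord] using this

lemma depth_swapWord (w : List (Fin 2)) : depth (swapWord w) = depth w := by
  simp only [depth, count_zero_swapWord, count_one_swapWord]
  omega

lemma wordWeight_swapWord (a b : ℝ) (w : List (Fin 2)) :
    wordWeight a b (swapWord w) = wordWeight b a w := by
  simp only [wordWeight, count_zero_swapWord, count_one_swapWord, mul_comm]

lemma swapWord_mem_stopWords {L : ℕ} {w : List (Fin 2)} (hw : w ∈ stopWords L) :
    swapWord w ∈ stopWords L := by
  obtain ⟨h1, h2⟩ := mem_stopWords.1 hw
  refine mem_stopWords.2 ⟨by rwa [depth_swapWord], fun c t h => ?_⟩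
  have h' : w = Equiv.swap 0 1 c :: swapWord t := by
    rw [← swapWord_swapWord w, h]; simp [swapWord]
  have := h2 _ _ h'
  rwa [depth_swapWord] at this

lemma sum_stopWords_swapWord (L : ℕ) (f : List (Fin 2) → ℝ) :
    ∑ w ∈ stopWords L, f (swapWord w) = ∑ w ∈ stopWords L, f w :=
  Finset.sum_bij' (fun w _ => swapWord w) (fun w _ => swapWord w)
    (fun _ => swapWord_mem_stopWords) (fun _ => swapWord_mem_stopWords)
    (fun w _ => swapWord_swapWord w) (fun w _ => swapWord_swapWord w) (fun _ _ => rfl)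

lemma stopSum_comm (a b : ℝ) (L : ℕ) : stopSum a b L = stopSum b a L := by
  simp only [stopSum]
  rw [← sum_stopWords_swapWord]
  simp only [wordWeight_swapWord]

/-! ### Exponential growth of the partition function -/

lemma pow_mul_pow_le_swap {a b : ℝ} (hb : 0 < b) (hab : b ≤ a) {k m : ℕ} (hkm : k ≤ m) :
    a ^ k * b ^ m ≤ a ^ m * b ^ k := by
  obtain ⟨d, rfl⟩ := Nat.exists_eq_add_of_le hkm
  have ha : 0 < a := hb.trans_le hab
  calc a ^ k * b ^ (k + d) = a ^ k * b ^ k * b ^ d := by ring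
    _ ≤ a ^ k * b ^ k * a ^ d := by gcongr
    _ = a ^ (k + d) * b ^ k := by ring

lemma pow_le_of_depth {z : ℝ} (hz : 0 < z) {L : ℕ} {w : List (Fin 2)}
    (hw : w ∈ stopWords L) : z ^ depth w ≤ (1 + z) * z ^ L := by
  obtain ⟨h1, h2⟩ := depth_le_of_mem_stopWords hw
  have hL : 0 < z ^ L := by positivity
  rcases (show depth w = L ∨ depth w = L + 1 by omega) with h | h <;> rw [h]
  · nlinarith
  · rw [pow_succ]; nlinarith

lemma le_pow_of_depth {z : ℝ} (hz : 0 < z) {L : ℕ} {w : List (Fin 2)}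
    (hw : w ∈ stopWords L) : z ^ L ≤ (1 + z⁻¹) * z ^ depth w := by
  have := pow_le_of_depth (inv_pos.2 hz) hw
  rw [inv_pow, inv_pow] at this
  have h1 : 0 < z ^ L := by positivity
  have h2 : 0 < z ^ depth w := by positivity
  calc z ^ L = (z ^ depth w)⁻¹ * (z ^ L * z ^ depth w) := by field_simp
    _ ≤ (1 + z⁻¹) * (z ^ L)⁻¹ * (z ^ L * z ^ depth w) := by gcongr
    _ = _ := by field_simp

/-- If `A z + B z² = 1` and `B ≤ A`, the Bernoulli weights `(A z, B z²)` and their exchange dominate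
the partition function. -/
lemma stopSum_le {A B z : ℝ} (hB : 0 < B) (hAB : B ≤ A) (hz : 0 < z)
    (h : A * z + B * z ^ 2 = 1) (L : ℕ) : stopSum A B L ≤ 2 * (1 + z⁻¹) * z⁻¹ ^ L := by
  have hA : 0 < A := hB.trans_le hAB
  have key : ∀ w ∈ stopWords L, wordWeight A B w ≤ (1 + z⁻¹) * z⁻¹ ^ L *
      (wordWeight (A * z) (B * z ^ 2) w + wordWeight (B * z ^ 2) (A * z) w) := by
    intro w hw
    have hzL := le_pow_of_depth hz hw
    have hzL0 : 0 < z ^ L := by positivity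
    have e1 : wordWeight A B w ≤ (z ^ depth w)⁻¹ *
        (wordWeight (A * z) (B * z ^ 2) w + wordWeight (B * z ^ 2) (A * z) w) := by
      have hp1 := wordWeight_pos (show 0 < A * z by positivity) (show 0 < B * z ^ 2 by positivity) w
      have hp2 := wordWeight_pos (show 0 < B * z ^ 2 by positivity) (show 0 < A * z by positivity) w
      rw [inv_mul_eq_div, le_div_iff₀ (by positivity)]
      rcases le_total (w.count 1) (w.count 0) with hkm | hkm
      · have : wordWeight A B w * z ^ depth w = wordWeight (A * z) (B * z ^ 2) w := by
          simp only [wordWeight, depth, min_eq_right hkm]; ring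
        linarith
      · have : A ^ w.count 1 * B ^ w.count 0 * z ^ depth w =
            wordWeight (B * z ^ 2) (A * z) w := by
          simp only [wordWeight, depth, min_eq_left hkm]; ring
        have h2 := pow_mul_pow_le_swap hB hAB hkm
        have h3 : wordWeight A B w * z ^ depth w ≤
            A ^ w.count 1 * B ^ w.count 0 * z ^ depth w := by
          unfold wordWeight; gcongr
        linarith
    refine e1.trans ?_
    have hp : 0 < wordWeight (A * z) (B * z ^ 2) w + wordWeight (B * z ^ 2) (A * z) w :=
      add_pos (wordWeight_pos (by positivity) (by positivity) w)
        (wordWeight_pos (by positivity) (by positivity) w)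
    gcongr
    rw [inv_pow, ← div_eq_mul_inv, le_div_iff₀ hzL0, inv_mul_eq_div, div_le_iff₀ (by positivity)]
    exact hzL
  have h1 := stopSum_eq_one h L
  have h2 := stopSum_eq_one ((add_comm _ _).trans h) L
  calc stopSum A B L ≤ ∑ w ∈ stopWords L, (1 + z⁻¹) * z⁻¹ ^ L *
      (wordWeight (A * z) (B * z ^ 2) w + wordWeight (B * z ^ 2) (A * z) w) :=
        Finset.sum_le_sum key
    _ = (1 + z⁻¹) * z⁻¹ ^ L * (stopSum (A * z) (B * z ^ 2) L + stopSum (B * z ^ 2) (A * z) L) := by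
        rw [← Finset.mul_sum, Finset.sum_add_distrib, stopSum, stopSum]
    _ = _ := by rw [h1, h2]; ring

/-- By symmetry, a Bernoulli measure that favours the letter `0` gives mass at least one half to the
stopping words with at least as many letters `0` as letters `1`. -/
lemma half_le_sum_filter {a b : ℝ} (hb : 0 < b) (hba : b ≤ a) (hab : a + b = 1) (L : ℕ) :
    1 / 2 ≤ ∑ w ∈ stopWords L with w.count 1 ≤ w.count 0, wordWeight a b w := by
  have ha : 0 < a := hb.trans_le hba
  have h1 := stopSum_eq_one hab L
  rw [stopSum, ← Finset.sum_filter_add_sum_filter_not _ (fun w => w.count 1 ≤ w.count 0)] at h1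
  have h2 : ∑ w ∈ stopWords L with ¬ w.count 1 ≤ w.count 0, wordWeight a b w ≤
      ∑ w ∈ stopWords L with w.count 1 ≤ w.count 0, wordWeight a b w := by
    calc ∑ w ∈ stopWords L with ¬ w.count 1 ≤ w.count 0, wordWeight a b w
        ≤ ∑ w ∈ stopWords L with ¬ w.count 1 ≤ w.count 0, wordWeight a b (swapWord w) := by
          refine Finset.sum_le_sum fun w hw => ?_
          have hw' := (Finset.mem_filter.1 hw).2
          rw [wordWeight_swapWord, wordWeight, wordWeight, mul_comm (b ^ _)]
          exact pow_mul_pow_le_swap hb hba (by omega)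
      _ = ∑ w ∈ stopWords L with w.count 1 > w.count 0, wordWeight a b (swapWord w) := by
          simp only [not_le, gt_iff_lt]
      _ = ∑ w ∈ stopWords L with w.count 1 < w.count 0, wordWeight a b w := by
          rw [Finset.sum_filter, Finset.sum_filter, ← sum_stopWords_swapWord]
          refine Finset.sum_congr rfl fun w _ => ?_
          rw [swapWord_swapWord]
          simp only [count_zero_swapWord, count_one_swapWord, gt_iff_lt]
      _ ≤ _ := by
          refine Finset.sum_le_sum_of_subset_of_nonneg ?_ fun w _ _ => (wordWeight_pos ha hb w).le
          intro w hw
          simp only [Finset.mem_filter] at hw ⊢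
          exact ⟨hw.1, hw.2.le⟩
  linarith

/-- The hypothesis `B z ≤ A` says that the Bernoulli weights `(A z, B z²)` favour the letter `0`, so
that the words for which `depth w = k + 2 * m` already carry half of the mass. -/
lemma le_stopSum {A B z : ℝ} (hA : 0 < A) (hB : 0 < B) (hz : 0 < z)
    (h : A * z + B * z ^ 2 = 1) (hle : B * z ≤ A) (L : ℕ) :
    (2 * (1 + z))⁻¹ * z⁻¹ ^ L ≤ stopSum A B L := by
  have hba : B * z ^ 2 ≤ A * z := by nlinarith
  have h1 := half_le_sum_filter (show 0 < B * z ^ 2 by positivity) hba h L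
  have hzL : 0 < z ^ L := by positivity
  calc (2 * (1 + z))⁻¹ * z⁻¹ ^ L = (1 + z)⁻¹ * z⁻¹ ^ L * (1 / 2) := by field_simp
    _ ≤ (1 + z)⁻¹ * z⁻¹ ^ L *
        ∑ w ∈ stopWords L with w.count 1 ≤ w.count 0, wordWeight (A * z) (B * z ^ 2) w := by gcongr
    _ ≤ ∑ w ∈ stopWords L with w.count 1 ≤ w.count 0, wordWeight A B w := by
        rw [Finset.mul_sum]
        refine Finset.sum_le_sum fun w hw => ?_
        obtain ⟨hw, hkm⟩ := Finset.mem_filter.1 hw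
        have e : wordWeight (A * z) (B * z ^ 2) w = wordWeight A B w * z ^ depth w := by
          simp only [wordWeight, depth, min_eq_right hkm]; ring
        have hw0 := wordWeight_pos hA hB w
        have := pow_le_of_depth hz hw
        calc (1 + z)⁻¹ * z⁻¹ ^ L * wordWeight (A * z) (B * z ^ 2) w
            = (1 + z)⁻¹ * z⁻¹ ^ L * wordWeight A B w * z ^ depth w := by rw [e]; ring
          _ ≤ (1 + z)⁻¹ * z⁻¹ ^ L * wordWeight A B w * ((1 + z) * z ^ L) := by gcongr
          _ = wordWeight A B w := by
            rw [inv_pow]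
            field_simp
    _ ≤ stopSum A B L :=
        Finset.sum_le_sum_of_subset_of_nonneg (Finset.filter_subset _ _)
          fun w _ _ => (wordWeight_pos hA hB w).le

/-! ### The critical regime -/

lemma wordWeight_half_mul (A B : ℝ) (w : List (Fin 2)) :
    wordWeight (1 / 2) (1 / 2) w * wordWeight (2 * A) (2 * B) w = wordWeight A B w := by
  simp only [wordWeight]
  rw [mul_mul_mul_comm, ← mul_pow, ← mul_pow]
  congr 2 <;> ring

/-- If the letter weights `X`, `Y` satisfy `X Y = ρ³`, a word has weight `ρ ^ depth` up to a factor
governed by the imbalance between its letters. -/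
lemma wordWeight_eq_pow_depth {X Y ρ : ℝ} (hρ : 0 < ρ) (h : X * Y = ρ ^ 3)
    (w : List (Fin 2)) :
    wordWeight X Y w = ρ ^ depth w *
      ((X / ρ) ^ (w.count 0 - w.count 1) * (Y / ρ) ^ (w.count 1 - w.count 0)) := by
  have key : ∀ n d : ℕ, X ^ (n + d) * Y ^ n = ρ ^ (3 * n + d) * (X / ρ) ^ d := by
    intro n d
    rw [pow_add, mul_right_comm, ← mul_pow, h, div_pow, pow_add, pow_mul]
    field_simp
  have key' : ∀ n d : ℕ, X ^ n * Y ^ (n + d) = ρ ^ (3 * n + d) * (Y / ρ) ^ d := by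
    intro n d
    rw [pow_add, ← mul_assoc, ← mul_pow, h, div_pow, pow_add, pow_mul]
    field_simp
  unfold wordWeight depth
  rcases le_total (w.count 1) (w.count 0) with hkm | hkm
  · obtain ⟨d, hd⟩ := Nat.exists_eq_add_of_le hkm
    rw [hd, key, Nat.add_sub_cancel_left, Nat.sub_eq_zero_of_le (by omega), pow_zero, mul_one]
    congr 2
    omega
  · obtain ⟨d, hd⟩ := Nat.exists_eq_add_of_le hkm
    rw [hd, key', Nat.add_sub_cancel_left, Nat.sub_eq_zero_of_le (by omega), pow_zero, one_mul]
    congr 2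
    omega

/-- In the critical regime each word is dominated by its uniform Bernoulli weight: with `X = 2 A` and
`Y = 2 B` both at most `ρ`, an imbalance between the letters can only decrease the weight. -/
lemma stopSum_le_of_critical {A B ρ : ℝ} (hA : 0 < A) (hB : 0 < B) (hρ : 0 < ρ)
    (h : 4 * A * B = ρ ^ 3) (hAρ : 2 * A ≤ ρ) (hBρ : 2 * B ≤ ρ) (L : ℕ) :
    stopSum A B L ≤ (1 + ρ) * ρ ^ L := by
  have h1 := stopSum_eq_one (show (1 / 2 : ℝ) + 1 / 2 = 1 by norm_num) L
  calc stopSum A B L ≤ ∑ w ∈ stopWords L, wordWeight (1 / 2) (1 / 2) w * ((1 + ρ) * ρ ^ L) := by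
        refine Finset.sum_le_sum fun w hw => ?_
        have hp := wordWeight_pos (show (0 : ℝ) < 1 / 2 by norm_num) (show (0 : ℝ) < 1 / 2 by norm_num) w
        rw [← wordWeight_half_mul A B w]
        gcongr
        rw [wordWeight_eq_pow_depth hρ (by linarith : 2 * A * (2 * B) = ρ ^ 3)]
        refine le_trans ?_ (pow_le_of_depth hρ hw)
        refine mul_le_of_le_one_right (by positivity) (mul_le_one₀ ?_ (by positivity) ?_)
        · exact pow_le_one₀ (by positivity) ((div_le_one hρ).2 hAρ)
        · exact pow_le_one₀ (by positivity) ((div_le_one hρ).2 hBρ)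
    _ = (1 + ρ) * ρ ^ L := by rw [← Finset.sum_mul, ← stopSum, h1, one_mul]

/-- The second moment of the imbalance of the stopped fair random walk. -/
lemma sum_sq_sub_le (L : ℕ) :
    ∑ w ∈ stopWords L, wordWeight (1 / 2) (1 / 2) w * ((w.count 0 : ℝ) - w.count 1) ^ 2 ≤ L + 1 := by
  have h0 := sum_stopWords_of_harmonic (fun w => wordWeight (1 / 2) (1 / 2) w *
    (((w.count 0 : ℝ) - w.count 1) ^ 2 - (w.count 0 + w.count 1))) (fun w => by
      simp only [wordWeight_zero_cons, wordWeight_one_cons]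
      simp
      ring) L
  have h1 := stopSum_eq_one (show (1 / 2 : ℝ) + 1 / 2 = 1 by norm_num) L
  simp only [mul_sub _ (_ ^ 2), Finset.sum_sub_distrib] at h0
  have h2 : ∑ w ∈ stopWords L, wordWeight (1 / 2) (1 / 2) w * ((w.count 0 : ℝ) + w.count 1) ≤
      ∑ w ∈ stopWords L, wordWeight (1 / 2) (1 / 2) w * (L + 1) := by
    refine Finset.sum_le_sum fun w hw => ?_
    have hp := wordWeight_pos (show (0 : ℝ) < 1 / 2 by norm_num) (show (0 : ℝ) < 1 / 2 by norm_num) w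
    have := (depth_le_of_mem_stopWords hw).2
    unfold depth at this
    exact mul_le_mul_of_nonneg_left
      (by exact_mod_cast (by omega : w.count 0 + w.count 1 ≤ L + 1)) hp.le
  rw [← Finset.sum_mul, ← stopSum, h1, one_mul] at h2
  simp [wordWeight] at h0
  simp [wordWeight] at h2 ⊢
  linarith

/-- The upper bound in the critical regime is sharp up to a factor `exp (O (√L))`, since by Chebyshev's
inequality most stopped words have an imbalance between their letters of order at most `√L`. -/
lemma le_stopSum_of_critical {A B ρ θ : ℝ} (hA : 0 < A) (hρ : 0 < ρ)
    (h : 4 * A * B = ρ ^ 3) (hθ : 0 < θ) (hθ1 : θ ≤ 1) (hAθ : θ * ρ ≤ 2 * A) (hBθ : θ * ρ ≤ 2 * B)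
    (L : ℕ) :
    3 / 4 * (1 + ρ⁻¹)⁻¹ * θ ^ (2 * √(L + 1)) * ρ ^ L ≤ stopSum A B L := by
  set r : ℝ := 2 * √(L + 1) with hr
  have hr0 : 0 < r := by positivity
  have hr2 : r ^ 2 = 4 * (L + 1) := by
    rw [hr, mul_pow, Real.sq_sqrt (by positivity)]; norm_num
  have h1 := stopSum_eq_one (show (1 / 2 : ℝ) + 1 / 2 = 1 by norm_num) L
  have h2 := sum_sq_sub_le L
  have key : ∀ w ∈ stopWords L, (1 + ρ⁻¹)⁻¹ * θ ^ r * ρ ^ L * (wordWeight (1 / 2) (1 / 2) w -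
      wordWeight (1 / 2) (1 / 2) w * ((w.count 0 : ℝ) - w.count 1) ^ 2 / r ^ 2) ≤
        wordWeight A B w := by
    intro w hw
    have hp := wordWeight_pos (show (0 : ℝ) < 1 / 2 by norm_num) (show (0 : ℝ) < 1 / 2 by norm_num) w
    rw [← wordWeight_half_mul A B w, wordWeight_eq_pow_depth hρ (by linarith : 2 * A * (2 * B) = ρ ^ 3)]
    set d : ℝ := |(w.count 0 : ℝ) - w.count 1| with hd
    have hd2 : ((w.count 0 : ℝ) - w.count 1) ^ 2 = d ^ 2 := (sq_abs _).symm
    have hd0 : 0 ≤ d := abs_nonneg _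
    have e1 : θ ^ d ≤ (2 * A / ρ) ^ (w.count 0 - w.count 1) *
        (2 * B / ρ) ^ (w.count 1 - w.count 0) := by
      have : θ ^ d = θ ^ (w.count 0 - w.count 1) * θ ^ (w.count 1 - w.count 0) := by
        rw [← pow_add, ← Real.rpow_natCast]
        congr 1
        rcases le_total (w.count 1) (w.count 0) with hkm | hkm
        · rw [hd, Nat.sub_eq_zero_of_le hkm, add_zero, Nat.cast_sub hkm,
            abs_of_nonneg (sub_nonneg.2 (Nat.cast_le.2 hkm))]
        · rw [hd, Nat.sub_eq_zero_of_le hkm, zero_add, Nat.cast_sub hkm, abs_sub_comm,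
            abs_of_nonneg (sub_nonneg.2 (Nat.cast_le.2 hkm))]
      rw [this]
      have hA' := (le_div_iff₀ hρ).2 hAθ
      have hB' := (le_div_iff₀ hρ).2 hBθ
      gcongr
    -- Chebyshev's inequality in pointwise form: the left side is not positive unless `d < r`
    have e2 : θ ^ r * (1 - d ^ 2 / r ^ 2) ≤ θ ^ d := by
      have hθr : 0 < θ ^ r := Real.rpow_pos_of_pos hθ r
      have hθd : 0 < θ ^ d := Real.rpow_pos_of_pos hθ d
      rcases le_total d r with hdr | hdr
      · have h3 : θ ^ r ≤ θ ^ d := Real.rpow_le_rpow_of_exponent_ge hθ hθ1 hdr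
        have : 0 ≤ d ^ 2 / r ^ 2 := by positivity
        nlinarith
      · have : 1 ≤ d ^ 2 / r ^ 2 := by rw [one_le_div (by positivity)]; gcongr
        nlinarith
    have e3 := le_pow_of_depth hρ hw
    have e4 : (1 + ρ⁻¹)⁻¹ * ρ ^ L ≤ ρ ^ depth w := by
      rw [inv_mul_le_iff₀ (by positivity)]; exact e3
    rw [hd2]
    calc (1 + ρ⁻¹)⁻¹ * θ ^ r * ρ ^ L * (wordWeight (1 / 2) (1 / 2) w -
          wordWeight (1 / 2) (1 / 2) w * d ^ 2 / r ^ 2)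
        = wordWeight (1 / 2) (1 / 2) w * (((1 + ρ⁻¹)⁻¹ * ρ ^ L) * (θ ^ r * (1 - d ^ 2 / r ^ 2))) := by
          ring
      _ ≤ wordWeight (1 / 2) (1 / 2) w * (((1 + ρ⁻¹)⁻¹ * ρ ^ L) * θ ^ d) := by gcongr
      _ ≤ wordWeight (1 / 2) (1 / 2) w * (ρ ^ depth w * ((2 * A / ρ) ^ (w.count 0 - w.count 1) *
        (2 * B / ρ) ^ (w.count 1 - w.count 0))) := by gcongr
  refine le_trans ?_ (Finset.sum_le_sum key)
  rw [← Finset.mul_sum, Finset.sum_sub_distrib, ← Finset.sum_div, ← stopSum, h1]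
  have hc : 0 ≤ (1 + ρ⁻¹)⁻¹ * θ ^ r * ρ ^ L := by positivity
  have : (∑ w ∈ stopWords L, wordWeight (1 / 2) (1 / 2) w * ((w.count 0 : ℝ) - w.count 1) ^ 2) / r ^ 2
      ≤ 1 / 4 := by
    rw [hr2, div_le_iff₀ (by positivity)]; linarith
  calc 3 / 4 * (1 + ρ⁻¹)⁻¹ * θ ^ r * ρ ^ L = (1 + ρ⁻¹)⁻¹ * θ ^ r * ρ ^ L * (1 - 1 / 4) := by ring
    _ ≤ _ := by gcongr

/-! ### Geometry of the coding map -/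

/-- The first `n` letters of the sequence `x`, last letter first. -/
def initialWord (x : ℕ → Fin 2) : ℕ → List (Fin 2)
  | 0 => []
  | n + 1 => x n :: initialWord x n

/-- The side length in direction `c` of the rectangle `f_w ([0, 1] ^ 2)`. -/
noncomputable def sideLength (c : Fin 2) (w : List (Fin 2)) : ℝ :=
  (w.map fun i => baranskiCarpet.a i c).prod

/-- The coordinate `c` of the point of the carpet coded by `x`. -/
noncomputable def carpetCoord (c : Fin 2) (x : ℕ → Fin 2) : ℝ :=
  ∑' n, sideLength c (initialWord x n) * baranskiCarpet.t (x n) c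

lemma length_initialWord (x : ℕ → Fin 2) (n : ℕ) : (initialWord x n).length = n := by
  induction n with
  | zero => rfl
  | succ n ih => simp [initialWord, ih]

lemma initialWord_eq_iff {x y : ℕ → Fin 2} {n : ℕ} :
    initialWord x n = initialWord y n ↔ ∀ i < n, x i = y i := by
  induction n with
  | zero => simp [initialWord]
  | succ n ih =>
    simp only [initialWord, List.cons.injEq, ih]
    exact ⟨fun h i hi => (Nat.lt_succ_iff_lt_or_eq.1 hi).elim (h.2 i) fun e => e ▸ h.1,
      fun h => ⟨h n (by omega), fun i hi => h i (by omega)⟩⟩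

/-- Every word is an initial word of a sequence, continued here by the letter `0`. -/
lemma initialWord_getD_reverse (w : List (Fin 2)) :
    initialWord (fun i => w.reverse.getD i 0) w.length = w := by
  induction w with
  | nil => rfl
  | cons c w ih =>
    rw [List.length_cons, initialWord]
    congr 1
    · simp [List.getD]
    · refine (initialWord_eq_iff.2 fun i hi => ?_).trans ih
      simp [List.getD, List.getElem?_append, hi]

lemma depth_initialWord_mono (x : ℕ → Fin 2) {i j : ℕ} (hij : i ≤ j) :
    depth (initialWord x i) + (j - i) ≤ depth (initialWord x j) := by
  induction j, hij using Nat.le_induction with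
  | base => simp
  | succ j hij ih =>
    have := (depth_cons (x j) (initialWord x j)).1
    rw [initialWord]
    omega

lemma exists_initialWord_mem_stopWords (x : ℕ → Fin 2) (L : ℕ) :
    ∃ n, initialWord x n ∈ stopWords L := by
  have hex : ∃ n, L ≤ depth (initialWord x n) :=
    ⟨L, by have := depth_initialWord_mono x (Nat.zero_le L); omega⟩
  classical
  refine ⟨Nat.find hex, mem_stopWords.2 ⟨Nat.find_spec hex, fun c t h => ?_⟩⟩
  rcases hn : Nat.find hex with _ | n
  · rw [hn] at h
    simp [initialWord] at h
  · rw [hn, initialWord] at h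
    obtain ⟨-, rfl⟩ := List.cons.inj h
    exact not_le.1 (Nat.find_min hex (by omega))

lemma depth_lt_of_initialWord_mem {x : ℕ → Fin 2} {L n j : ℕ}
    (h : initialWord x n ∈ stopWords L) (hj : j < n) : depth (initialWord x j) < L := by
  obtain ⟨n, rfl⟩ : ∃ n', n = n' + 1 := ⟨n - 1, by omega⟩
  have h1 := (mem_stopWords.1 h).2 _ _ rfl
  have h2 := depth_initialWord_mono x (show j ≤ n by omega)
  omega

lemma sideLength_cons (c i : Fin 2) (w : List (Fin 2)) :
    sideLength c (i :: w) = baranskiCarpet.a i c * sideLength c w := by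
  simp [sideLength]

lemma sideLength_zero (w : List (Fin 2)) :
    sideLength 0 w = (1 / 2) ^ (w.count 0 + 2 * w.count 1) := by
  induction w with
  | nil => simp [sideLength]
  | cons i w ih =>
    rw [sideLength_cons, ih]
    fin_cases i
    · simp [baranskiCarpet, pow_add]; ring
    · simp [baranskiCarpet, pow_add, mul_add]; ring

lemma sideLength_one (w : List (Fin 2)) :
    sideLength 1 w = (1 / 2) ^ (2 * w.count 0 + w.count 1) := by
  induction w with
  | nil => simp [sideLength]
  | cons i w ih =>
    rw [sideLength_cons, ih]
    fin_cases i
    · simp [baranskiCarpet, pow_add, mul_add]; ring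
    · simp [baranskiCarpet, pow_add]; ring

lemma sideLength_pos (c : Fin 2) (w : List (Fin 2)) : 0 < sideLength c w := by
  fin_cases c
  · simp only [Fin.zero_eta, sideLength_zero]; positivity
  · simp only [Fin.mk_one, sideLength_one]; positivity

lemma sideLength_le (c : Fin 2) (w : List (Fin 2)) : sideLength c w ≤ (1 / 2) ^ depth w := by
  fin_cases c
  · simp only [Fin.zero_eta, sideLength_zero]
    exact pow_le_pow_of_le_one (by norm_num) (by norm_num) (by unfold depth; omega)
  · simp only [Fin.mk_one, sideLength_one]
    exact pow_le_pow_of_le_one (by norm_num) (by norm_num) (by unfold depth; omega)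

lemma exists_sideLength_eq (w : List (Fin 2)) : ∃ c, sideLength c w = (1 / 2) ^ depth w := by
  rcases le_total (w.count 1) (w.count 0) with h | h
  · exact ⟨0, by rw [sideLength_zero]; congr 1; unfold depth; omega⟩
  · exact ⟨1, by rw [sideLength_one]; congr 1; unfold depth; omega⟩

lemma carpet_t_nonneg (i c : Fin 2) : 0 ≤ baranskiCarpet.t i c := by
  fin_cases i <;> fin_cases c <;> norm_num [baranskiCarpet]

lemma carpet_t_add_a_le (i c : Fin 2) : baranskiCarpet.t i c + baranskiCarpet.a i c ≤ 1 := by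
  fin_cases i <;> fin_cases c <;> simp [baranskiCarpet] <;> norm_num

lemma carpet_a_pos (i c : Fin 2) : 0 < baranskiCarpet.a i c := by
  fin_cases i <;> fin_cases c <;> simp [baranskiCarpet]

lemma carpetCoord_term_nonneg (c : Fin 2) (x : ℕ → Fin 2) (n : ℕ) :
    0 ≤ sideLength c (initialWord x n) * baranskiCarpet.t (x n) c :=
  mul_nonneg (sideLength_pos _ _).le (carpet_t_nonneg _ _)

lemma carpetCoord_term_le (c : Fin 2) (x : ℕ → Fin 2) (n : ℕ) :
    sideLength c (initialWord x n) * baranskiCarpet.t (x n) c ≤ (1 / 2) ^ n := by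
  have h1 : sideLength c (initialWord x n) ≤ (1 / 2) ^ n := by
    refine (sideLength_le _ _).trans (pow_le_pow_of_le_one (by norm_num) (by norm_num) ?_)
    have := depth_initialWord_mono x (Nat.zero_le n)
    omega
  have h2 : baranskiCarpet.t (x n) c ≤ 1 := by
    linarith [carpet_t_add_a_le (x n) c, carpet_a_pos (x n) c]
  have := sideLength_pos c (initialWord x n)
  have := carpet_t_nonneg (x n) c
  nlinarith

lemma summable_carpetCoord (c : Fin 2) (x : ℕ → Fin 2) :
    Summable fun n => sideLength c (initialWord x n) * baranskiCarpet.t (x n) c :=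
  Summable.of_nonneg_of_le (carpetCoord_term_nonneg c x) (carpetCoord_term_le c x)
    summable_geometric_two

lemma carpetCoord_nonneg (c : Fin 2) (x : ℕ → Fin 2) : 0 ≤ carpetCoord c x :=
  tsum_nonneg (carpetCoord_term_nonneg c x)

lemma carpetCoord_le_one (c : Fin 2) (x : ℕ → Fin 2) : carpetCoord c x ≤ 1 := by
  have key : ∀ n, ∑ i ∈ Finset.range n, sideLength c (initialWord x i) * baranskiCarpet.t (x i) c +
      sideLength c (initialWord x n) ≤ 1 := by
    intro n
    induction n with
    | zero => simp [initialWord, sideLength]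
    | succ n ih =>
      rw [Finset.sum_range_succ, initialWord, sideLength_cons]
      have := sideLength_pos c (initialWord x n)
      have := carpet_t_add_a_le (x n) c
      nlinarith
  refine Real.tsum_le_of_sum_range_le (carpetCoord_term_nonneg c x) fun n => ?_
  linarith [key n, sideLength_pos c (initialWord x n)]

/-- Self-similarity of the coding map, coordinate by coordinate. -/
lemma carpetCoord_eq (c : Fin 2) (x : ℕ → Fin 2) :
    carpetCoord c x = baranskiCarpet.t (x 0) c +
      baranskiCarpet.a (x 0) c * carpetCoord c fun i => x (i + 1) := by
  have h : ∀ n, sideLength c (initialWord x (n + 1)) =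
      baranskiCarpet.a (x 0) c * sideLength c (initialWord (fun i => x (i + 1)) n) := by
    intro n
    induction n with
    | zero => simp [initialWord, sideLength]
    | succ n ih =>
      rw [initialWord, sideLength_cons, ih, initialWord, sideLength_cons]
      ring
  rw [carpetCoord, (summable_carpetCoord c x).tsum_eq_zero_add, carpetCoord, ← tsum_mul_left]
  simp only [h, mul_assoc]
  simp [initialWord, sideLength]

lemma carpetCoord_sub_eq (c : Fin 2) {x y : ℕ → Fin 2} {n : ℕ} (h : ∀ i < n, x i = y i) :
    carpetCoord c x - carpetCoord c y = sideLength c (initialWord x n) *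
      (carpetCoord c (fun i => x (i + n)) - carpetCoord c fun i => y (i + n)) := by
  induction n with
  | zero => simp [initialWord, sideLength]
  | succ n ih =>
    rw [ih fun i hi => h i (by omega), carpetCoord_eq c fun i => x (i + n),
      carpetCoord_eq c fun i => y (i + n), initialWord, sideLength_cons]
    simp only [zero_add, add_right_comm _ 1 n, ← add_assoc]
    rw [← h n (by omega)]
    ring

/-- The two maps of the carpet have separated images in both coordinate projections. -/
lemma quarter_le_abs_sub (c : Fin 2) {x y : ℕ → Fin 2} (h : x 0 ≠ y 0) :
    1 / 4 ≤ |carpetCoord c x - carpetCoord c y| := by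
  rw [carpetCoord_eq c x, carpetCoord_eq c y]
  have h1 := carpetCoord_nonneg c fun i => x (i + 1)
  have h2 := carpetCoord_nonneg c fun i => y (i + 1)
  have h3 := carpetCoord_le_one c fun i => x (i + 1)
  have h4 := carpetCoord_le_one c fun i => y (i + 1)
  have hletter : ∀ i : Fin 2, i = 0 ∨ i = 1 := by decide
  rcases hletter (x 0) with hx | hx <;> rcases hletter (y 0) with hy | hy
  · exact absurd (hx.trans hy.symm) h
  · rw [hx, hy, abs_sub_comm, le_abs]
    left
    fin_cases c <;> simp [baranskiCarpet] at * <;> linarith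
  · rw [hx, hy, le_abs]
    left
    fin_cases c <;> simp [baranskiCarpet] at * <;> linarith
  · exact absurd (hx.trans hy.symm) h

lemma carpet_comp_apply (x : ℕ → Fin 2) (n : ℕ) (p : EuclideanSpace ℝ (Fin 2)) (c : Fin 2) :
    baranskiCarpet.comp x n p c = sideLength c (initialWord x n) * p c +
      ∑ i ∈ Finset.range n, sideLength c (initialWord x i) * baranskiCarpet.t (x i) c := by
  induction n generalizing p with
  | zero => simp [DiagonalIFS.comp, initialWord, sideLength]
  | succ n ih =>
    rw [DiagonalIFS.comp, Function.comp_apply, ih, Finset.sum_range_succ, initialWord,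
      sideLength_cons]
    simp only [DiagonalIFS.map]
    ring

lemma carpet_proj_eq (x : ℕ → Fin 2) :
    baranskiCarpet.proj x = WithLp.toLp 2 fun c => carpetCoord c x := by
  refine Tendsto.limUnder_eq ?_
  have h : Tendsto (fun n c => baranskiCarpet.comp x n 0 c) atTop (𝓝 fun c => carpetCoord c x) := by
    refine tendsto_pi_nhds.2 fun c => ?_
    simp only [carpet_comp_apply, PiLp.zero_apply, mul_zero, zero_add]
    exact (summable_carpetCoord c x).hasSum.tendsto_sum_nat
  exact ((PiLp.continuous_toLp 2 _).tendsto _).comp h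

lemma carpet_proj_apply (x : ℕ → Fin 2) (c : Fin 2) :
    baranskiCarpet.proj x c = carpetCoord c x := by rw [carpet_proj_eq]

/-- The first `n` letters depend continuously on the sequence, for the discrete topology on words. -/
lemma continuous_initialWord (n : ℕ) : Continuous[_, ⊥] fun x : ℕ → Fin 2 => initialWord x n := by
  let _ : TopologicalSpace (List (Fin 2)) := ⊥
  have : DiscreteTopology (List (Fin 2)) := ⟨rfl⟩
  induction n with
  | zero => exact continuous_const
  | succ n ih =>
    exact (continuous_of_discreteTopology (f := fun p : Fin 2 × List (Fin 2) => p.1 :: p.2)).comp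
      ((continuous_apply n).prodMk ih)

lemma continuous_carpet_proj : Continuous baranskiCarpet.proj := by
  have h : ∀ c, Continuous (carpetCoord c) := by
    intro c
    refine continuous_tsum (fun n => ?_) summable_geometric_two fun n x => ?_
    · let _ : TopologicalSpace (List (Fin 2)) := ⊥
      have : DiscreteTopology (List (Fin 2)) := ⟨rfl⟩
      exact (continuous_of_discreteTopology (f := sideLength c)).comp (continuous_initialWord n)
        |>.mul ((continuous_of_discreteTopology (f := fun i => baranskiCarpet.t i c)).comp
          (continuous_apply n))
    · rw [Real.norm_of_nonneg (carpetCoord_term_nonneg c x n)]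
      exact carpetCoord_term_le c x n
  simp only [funext carpet_proj_eq]
  exact (PiLp.continuous_toLp 2 _).comp (continuous_pi h)

lemma dist_carpet_proj_le {x y : ℕ → Fin 2} {n : ℕ} (h : ∀ i < n, x i = y i) :
    dist (baranskiCarpet.proj x) (baranskiCarpet.proj y) ≤
      2 * (1 / 2) ^ depth (initialWord x n) := by
  have key : ∀ c, |carpetCoord c x - carpetCoord c y| ≤ (1 / 2) ^ depth (initialWord x n) := by
    intro c
    rw [carpetCoord_sub_eq c h, abs_mul, abs_of_pos (sideLength_pos _ _)]
    refine (mul_le_of_le_one_right (sideLength_pos _ _).le ?_).trans (sideLength_le _ _)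
    have h1 := carpetCoord_nonneg c fun i => x (i + n)
    have h2 := carpetCoord_nonneg c fun i => y (i + n)
    have h3 := carpetCoord_le_one c fun i => x (i + n)
    have h4 := carpetCoord_le_one c fun i => y (i + n)
    exact abs_le.2 ⟨by linarith, by linarith⟩
  rw [EuclideanSpace.dist_eq, Fin.sum_univ_two]
  simp only [carpet_proj_apply, Real.dist_eq]
  refine Real.sqrt_le_iff.2 ⟨by positivity, ?_⟩
  have h0 := key 0
  have h1 := key 1
  have h2 := abs_nonneg (carpetCoord 0 x - carpetCoord 0 y)
  have h3 := abs_nonneg (carpetCoord 1 x - carpetCoord 1 y)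
  nlinarith

lemma le_dist_carpet_proj {x y : ℕ → Fin 2} {n : ℕ} (h : ∀ i < n, x i = y i) (hn : x n ≠ y n) :
    (1 / 2) ^ (depth (initialWord x n) + 2) ≤
      dist (baranskiCarpet.proj x) (baranskiCarpet.proj y) := by
  obtain ⟨c, hc⟩ := exists_sideLength_eq (initialWord x n)
  have h1 : |carpetCoord c x - carpetCoord c y| ≤
      dist (baranskiCarpet.proj x) (baranskiCarpet.proj y) := by
    have := PiLp.dist_apply_le (p := 2) (baranskiCarpet.proj x) (baranskiCarpet.proj y) c
    rwa [carpet_proj_apply, carpet_proj_apply, Real.dist_eq] at this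
  refine le_trans ?_ h1
  rw [carpetCoord_sub_eq c h, abs_mul, abs_of_pos (sideLength_pos _ _), hc, pow_add]
  have := quarter_le_abs_sub c (x := fun i => x (i + n)) (y := fun i => y (i + n)) (by simpa using hn)
  norm_num at this ⊢
  linarith

/-- Points of the carpet whose codes differ before the stopping time at level `L` are separated
on the scale `2 ^ (- L)`. -/
lemma le_dist_of_initialWord_ne {x y : ℕ → Fin 2} {L n : ℕ} (hx : initialWord x n ∈ stopWords L)
    (hne : initialWord x n ≠ initialWord y n) :
    (1 / 2) ^ (L + 1) ≤ dist (baranskiCarpet.proj x) (baranskiCarpet.proj y) := by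
  have hex : ∃ i, i < n ∧ x i ≠ y i := by
    by_contra! hcon
    exact hne (initialWord_eq_iff.2 hcon)
  classical
  have hj := Nat.find_spec hex
  have hmin : ∀ i < Nat.find hex, x i = y i := fun i hi => by
    by_contra hne'
    exact Nat.find_min hex hi ⟨hi.trans hj.1, hne'⟩
  refine le_trans ?_ (le_dist_carpet_proj hmin hj.2)
  have := depth_lt_of_initialWord_mem hx hj.1
  exact pow_le_pow_of_le_one (by norm_num) (by norm_num) (by omega)

/-! ### The Bernoulli measure -/

section Measure

variable {u : ℝ}

lemma isProbabilityMeasure_letter (h0 : 0 < u) (h1 : u < 1) :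
    IsProbabilityMeasure
      (∑ i, ENNReal.ofReal ((![u, 1 - u] : Fin 2 → ℝ) i) • (Measure.dirac i : Measure (Fin 2))) := by
  refine ⟨?_⟩
  rw [Fin.sum_univ_two]
  simp only [Measure.add_apply, Measure.smul_apply, measure_univ, smul_eq_mul, mul_one]
  rw [← ENNReal.ofReal_add] <;> simp <;> linarith

lemma bernoulliMeasure_cylinder (h0 : 0 < u) (h1 : u < 1) (x : ℕ → Fin 2) (n : ℕ) :
    DiagonalIFS.bernoulliMeasure ![u, 1 - u] {y | initialWord y n = initialWord x n} =
      ENNReal.ofReal (wordWeight u (1 - u) (initialWord x n)) := by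
  have hprob : ∀ _ : ℕ, IsProbabilityMeasure (∑ i, ENNReal.ofReal ((![u, 1 - u] : Fin 2 → ℝ) i) •
    (Measure.dirac i : Measure (Fin 2))) := fun _ => isProbabilityMeasure_letter h0 h1
  have hset : {y | initialWord y n = initialWord x n} =
      Set.pi (Finset.range n) fun i => {x i} := by
    ext y
    simp [initialWord_eq_iff]
  have hsingle : ∀ i : Fin 2, (∑ i, ENNReal.ofReal ((![u, 1 - u] : Fin 2 → ℝ) i) •
      (Measure.dirac i : Measure (Fin 2))) {i} = ENNReal.ofReal ((![u, 1 - u] : Fin 2 → ℝ) i) := by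
    intro i
    rw [Fin.sum_univ_two]
    fin_cases i <;> simp
  rw [hset, DiagonalIFS.bernoulliMeasure, Measure.infinitePi_pi _ (hμ := hprob) fun i _ => measurableSet_singleton _]
  simp only [hsingle]
  induction n with
  | zero => simp [initialWord, wordWeight]
  | succ n ih =>
    rw [Finset.prod_range_succ, ih (by ext y; simp [initialWord_eq_iff]), initialWord]
    have hw := wordWeight_pos h0 (sub_pos.2 h1) (initialWord x n)
    rw [← ENNReal.ofReal_mul hw.le]
    rcases (by decide : ∀ i : Fin 2, i = 0 ∨ i = 1) (x n) with hx | hx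
    · rw [hx, wordWeight_zero_cons, mul_comm]; rfl
    · rw [hx, wordWeight_one_cons, mul_comm]; rfl

lemma selfAffineMeasure_closedBall (p : EuclideanSpace ℝ (Fin 2)) (δ : ℝ) :
    baranskiCarpet.selfAffineMeasure ![u, 1 - u] (Metric.closedBall p δ) =
      DiagonalIFS.bernoulliMeasure ![u, 1 - u] {y | dist (baranskiCarpet.proj y) p ≤ δ} := by
  rw [DiagonalIFS.selfAffineMeasure,
    Measure.map_apply continuous_carpet_proj.measurable Metric.isClosed_closedBall.measurableSet]
  rfl

lemma support_selfAffineMeasure (h0 : 0 < u) (h1 : u < 1) :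
    (baranskiCarpet.selfAffineMeasure ![u, 1 - u]).support = range baranskiCarpet.proj := by
  apply Subset.antisymm
  · have hcl : IsClosed (range baranskiCarpet.proj) :=
      (isCompact_range continuous_carpet_proj).isClosed
    refine Measure.support_subset_of_isClosed hcl ?_
    rw [mem_ae_iff, DiagonalIFS.selfAffineMeasure, Measure.map_apply
      continuous_carpet_proj.measurable hcl.measurableSet.compl]
    simp
  · rintro _ ⟨x, rfl⟩
    rw [Measure.mem_support_iff_forall]
    intro U hU
    obtain ⟨ε, hε, hεU⟩ := Metric.nhds_basis_closedBall.mem_iff.1 hU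
    refine lt_of_lt_of_le ?_ (measure_mono hεU)
    rw [selfAffineMeasure_closedBall]
    obtain ⟨n, hn⟩ := exists_pow_lt_of_lt_one (half_pos hε) (show (1 / 2 : ℝ) < 1 by norm_num)
    refine lt_of_lt_of_le ?_ (measure_mono (s := {y | initialWord y n = initialWord x n}) ?_)
    · rw [bernoulliMeasure_cylinder h0 h1]
      exact ENNReal.ofReal_pos.2 (wordWeight_pos h0 (sub_pos.2 h1) _)
    · intro y hy
      have h2 := dist_carpet_proj_le (initialWord_eq_iff.1 hy)
      have h3 : (1 / 2 : ℝ) ^ depth (initialWord y n) ≤ (1 / 2) ^ n := by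
        refine pow_le_pow_of_le_one (by norm_num) (by norm_num) ?_
        have := depth_initialWord_mono y (Nat.zero_le n)
        omega
      show dist _ _ ≤ ε
      linarith

end Measure

/-! ### Packing sums and the partition function -/

lemma wordWeight_rpow {a b : ℝ} (ha : 0 < a) (hb : 0 < b) (q : ℝ) (w : List (Fin 2)) :
    wordWeight a b w ^ q = wordWeight (a ^ q) (b ^ q) w := by
  unfold wordWeight
  rw [Real.mul_rpow (by positivity) (by positivity), ← Real.rpow_natCast a, ← Real.rpow_natCast b,
    ← Real.rpow_natCast (a ^ q), ← Real.rpow_natCast (b ^ q), ← Real.rpow_mul ha.le,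
    ← Real.rpow_mul hb.le, ← Real.rpow_mul ha.le, ← Real.rpow_mul hb.le, mul_comm q, mul_comm q]

lemma rpow_le_of_comparable {w b κ : ℝ} (hw : 0 < w) (hb : 0 < b) (hκ : 1 ≤ κ) (h1 : w ≤ κ * b)
    (h2 : b ≤ κ * w) (q : ℝ) : b ^ q ≤ κ ^ |q| * w ^ q := by
  have hκ0 : 0 < κ := by linarith
  rcases le_total 0 q with hq | hq
  · rw [abs_of_nonneg hq, ← Real.mul_rpow hκ0.le hw.le]
    exact Real.rpow_le_rpow hb.le h2 hq
  · rw [abs_of_nonpos hq, Real.rpow_neg hκ0.le, ← Real.inv_rpow hκ0.le,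
      ← Real.mul_rpow (by positivity) hw.le]
    refine Real.rpow_le_rpow_of_nonpos (by positivity) ?_ hq
    rwa [inv_mul_le_iff₀ hκ0]

section Packing

variable {u : ℝ}

lemma wordWeight_initialWord_le (h0 : 0 < u) (h1 : u < 1) (x : ℕ → Fin 2) (n d : ℕ) :
    min u (1 - u) ^ d * wordWeight u (1 - u) (initialWord x n) ≤
        wordWeight u (1 - u) (initialWord x (n + d)) := by
  induction d with
  | zero => simp
  | succ d ih =>
    rw [← add_assoc, initialWord]
    have hmin : 0 < min u (1 - u) := lt_min h0 (by linarith)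
    have hw := wordWeight_pos h0 (sub_pos.2 h1) (initialWord x (n + d))
    calc min u (1 - u) ^ (d + 1) * wordWeight u (1 - u) (initialWord x n)
        = min u (1 - u) * (min u (1 - u) ^ d * wordWeight u (1 - u) (initialWord x n)) := by ring
      _ ≤ min u (1 - u) * wordWeight u (1 - u) (initialWord x (n + d)) := by gcongr
      _ ≤ _ := by
        rcases (by decide : ∀ i : Fin 2, i = 0 ∨ i = 1) (x (n + d)) with hx | hx
        · rw [hx, wordWeight_zero_cons]
          gcongr
          exact min_le_left _ _
        · rw [hx, wordWeight_one_cons]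
          gcongr
          exact min_le_right _ _

/-- A ball of radius about `2 ^ (- J)` has the mass of the stopping cylinders around its centre at
nearby levels. -/
lemma exists_measure_closedBall_eq (h0 : 0 < u) (h1 : u < 1) {x : ℕ → Fin 2} {J n₀ n₁ : ℕ} {δ : ℝ}
    (hδ1 : (1 / 2) ^ (J + 4) < δ) (hδ2 : δ ≤ (1 / 2) ^ (J + 3))
    (hn₀ : initialWord x n₀ ∈ stopWords J) (hn₁ : initialWord x n₁ ∈ stopWords (J + 5)) :
    ∃ b, baranskiCarpet.selfAffineMeasure ![u, 1 - u]
        (Metric.closedBall (baranskiCarpet.proj x) δ) = ENNReal.ofReal b ∧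
      wordWeight u (1 - u) (initialWord x n₁) ≤ b ∧
      b ≤ wordWeight u (1 - u) (initialWord x n₀) ∧
      wordWeight u (1 - u) (initialWord x n₀) ≤
        (min u (1 - u) ^ 6)⁻¹ * wordWeight u (1 - u) (initialWord x n₁) := by
  have hw₀ := wordWeight_pos h0 (sub_pos.2 h1) (initialWord x n₀)
  have hmin : 0 < min u (1 - u) := lt_min h0 (by linarith)
  have hup : baranskiCarpet.selfAffineMeasure ![u, 1 - u]
      (Metric.closedBall (baranskiCarpet.proj x) δ) ≤
        ENNReal.ofReal (wordWeight u (1 - u) (initialWord x n₀)) := by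
    rw [selfAffineMeasure_closedBall, ← bernoulliMeasure_cylinder h0 h1]
    refine measure_mono fun y hy => ?_
    by_contra hne
    have h2 := le_dist_of_initialWord_ne hn₀ (y := y) (fun h => hne h.symm)
    have h3 : dist (baranskiCarpet.proj y) (baranskiCarpet.proj x) ≤ δ := hy
    rw [dist_comm] at h3
    have h4 : (1 / 2 : ℝ) ^ (J + 3) < (1 / 2) ^ (J + 1) :=
      pow_lt_pow_right_of_lt_one₀ (by norm_num) (by norm_num) (by omega)
    linarith
  have hlow : ENNReal.ofReal (wordWeight u (1 - u) (initialWord x n₁)) ≤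
      baranskiCarpet.selfAffineMeasure ![u, 1 - u]
        (Metric.closedBall (baranskiCarpet.proj x) δ) := by
    rw [selfAffineMeasure_closedBall, ← bernoulliMeasure_cylinder h0 h1]
    refine measure_mono fun y hy => ?_
    have h2 := dist_carpet_proj_le (initialWord_eq_iff.1 hy)
    have h3 : initialWord y n₁ = initialWord x n₁ := hy
    rw [h3] at h2
    have h4 : (1 / 2 : ℝ) ^ depth (initialWord x n₁) ≤ (1 / 2) ^ (J + 5) :=
      pow_le_pow_of_le_one (by norm_num) (by norm_num) (depth_le_of_mem_stopWords hn₁).1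
    have h5 : 2 * (1 / 2 : ℝ) ^ (J + 5) = (1 / 2) ^ (J + 4) := by rw [pow_succ]; ring
    show dist _ _ ≤ δ
    linarith
  have hfin := (hup.trans_lt ENNReal.ofReal_lt_top).ne
  refine ⟨_, (ENNReal.ofReal_toReal hfin).symm, (ENNReal.ofReal_le_iff_le_toReal hfin).1 hlow,
    ENNReal.toReal_le_of_le_ofReal hw₀.le hup, ?_⟩
  -- every letter increases the depth, so at most six letters separate the two levels
  have hle : n₀ ≤ n₁ := by
    by_contra! hlt
    have h2 := depth_lt_of_initialWord_mem hn₀ hlt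
    have h3 := (depth_le_of_mem_stopWords hn₁).1
    omega
  have h6 : n₁ ≤ n₀ + 6 := by
    have h2 := depth_initialWord_mono x hle
    have h3 := (depth_le_of_mem_stopWords hn₁).2
    have h4 := (depth_le_of_mem_stopWords hn₀).1
    omega
  have h7 := wordWeight_initialWord_le h0 h1 x n₀ (n₁ - n₀)
  rw [Nat.add_sub_cancel' hle] at h7
  rw [← div_eq_inv_mul, le_div_iff₀ (by positivity), mul_comm]
  refine le_trans ?_ h7
  have : min u (1 - u) ^ 6 ≤ min u (1 - u) ^ (n₁ - n₀) :=
    pow_le_pow_of_le_one hmin.le ((min_le_left _ _).trans h1.le) (by omega)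
  gcongr

lemma exists_packingSum_bounds (h0 : 0 < u) (h1 : u < 1) (q : ℝ) : ∃ C : ℝ, 0 < C ∧
    ∀ (J : ℕ) (δ : ℝ), (1 / 2) ^ (J + 4) < δ → δ ≤ (1 / 2) ^ (J + 3) →
      ENNReal.ofReal (C⁻¹ * stopSum (u ^ q) ((1 - u) ^ q) J) ≤
        packingSum (baranskiCarpet.selfAffineMeasure ![u, 1 - u]) q δ ∧
      packingSum (baranskiCarpet.selfAffineMeasure ![u, 1 - u]) q δ ≤
        ENNReal.ofReal (C * stopSum (u ^ q) ((1 - u) ^ q) (J + 5)) := by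
  have hu' : 0 < 1 - u := by linarith
  have hmin : 0 < min u (1 - u) := lt_min h0 hu'
  set κ : ℝ := (min u (1 - u) ^ 6)⁻¹ with hκ
  have hκ1 : 1 ≤ κ := (one_le_inv₀ (by positivity)).2
    (pow_le_one₀ hmin.le ((min_le_left _ _).trans h1.le))
  have hκ0 : 0 < κ := by linarith
  have hwpos : ∀ w, 0 < wordWeight (u ^ q) ((1 - u) ^ q) w :=
    wordWeight_pos (Real.rpow_pos_of_pos h0 q) (Real.rpow_pos_of_pos hu' q)
  refine ⟨κ ^ |q|, Real.rpow_pos_of_pos hκ0 _, fun J δ hδ1 hδ2 => ⟨?_, ?_⟩⟩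
  · -- one centre is placed in every stopping cylinder
    classical
    let p : List (Fin 2) → EuclideanSpace ℝ (Fin 2) := fun w =>
      baranskiCarpet.proj fun i => w.reverse.getD i 0
    have hsep : ∀ w ∈ stopWords J, ∀ w' ∈ stopWords J, w ≠ w' →
        (1 / 2) ^ (J + 1) ≤ dist (p w) (p w') := by
      intro w hw w' hw' hne
      rcases lt_or_ge (w.length) (w'.length) with hlt | hge
      · rw [dist_comm]
        refine le_dist_of_initialWord_ne (n := w'.length) (by rwa [initialWord_getD_reverse]) ?_
        rw [initialWord_getD_reverse]
        intro h
        have hw2 := hw'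
        rw [h] at hw2
        have := depth_lt_of_initialWord_mem hw2 hlt
        rw [initialWord_getD_reverse] at this
        have := (depth_le_of_mem_stopWords hw).1
        omega
      · refine le_dist_of_initialWord_ne (n := w.length) (by rwa [initialWord_getD_reverse]) ?_
        rw [initialWord_getD_reverse]
        intro h
        rcases hge.eq_or_lt with heq | hlt
        · rw [← heq, initialWord_getD_reverse] at h
          exact hne h
        · have hw2 := hw
          rw [h] at hw2
          have := depth_lt_of_initialWord_mem hw2 hlt
          rw [initialWord_getD_reverse] at this
          have := (depth_le_of_mem_stopWords hw').1
          omega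
    have hpow : (1 / 2 : ℝ) ^ (J + 1) = 4 * (1 / 2) ^ (J + 3) := by
      rw [pow_succ _ (J + 2), pow_succ _ (J + 1)]; ring
    have hδ0 : 0 < δ := lt_trans (by positivity) hδ1
    have hinj : Set.InjOn p (stopWords J) := by
      intro w hw w' hw' h
      by_contra hne
      have h2 := hsep w hw w' hw' hne
      rw [h, dist_self] at h2
      exact absurd h2 (not_le.2 (by positivity))
    refine le_iSup_of_le ((stopWords J).image p) (le_iSup_of_le ?_ (le_iSup_of_le ?_ ?_))
    · rw [support_selfAffineMeasure h0 h1]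
      intro y hy
      obtain ⟨w, -, rfl⟩ := Finset.mem_image.1 (Finset.mem_coe.1 hy)
      exact mem_range_self _
    · intro y hy y' hy' hne
      obtain ⟨w, hw, rfl⟩ := Finset.mem_image.1 (Finset.mem_coe.1 hy)
      obtain ⟨w', hw', rfl⟩ := Finset.mem_image.1 (Finset.mem_coe.1 hy')
      refine Metric.closedBall_disjoint_closedBall ?_
      have h2 := hsep w hw w' hw' fun h => hne (by rw [h])
      linarith
    · rw [Finset.sum_image hinj, stopSum, Finset.mul_sum, ENNReal.ofReal_sum_of_nonneg
        fun w _ => by have := hwpos w; positivity]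
      refine Finset.sum_le_sum fun w hw => ?_
      obtain ⟨n₁, hn₁⟩ := exists_initialWord_mem_stopWords (fun i => w.reverse.getD i 0) (J + 5)
      obtain ⟨b, hb, hb1, hb2, hb3⟩ := exists_measure_closedBall_eq h0 h1 hδ1 hδ2
        (by rwa [initialWord_getD_reverse]) hn₁
      rw [initialWord_getD_reverse] at hb2 hb3
      have hb0 : 0 < b := (wordWeight_pos h0 hu' _).trans_le hb1
      have hw0 := wordWeight_pos h0 hu' w
      rw [hb, ENNReal.ofReal_rpow_of_pos hb0]
      refine ENNReal.ofReal_le_ofReal ?_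
      rw [← wordWeight_rpow h0 hu', inv_mul_le_iff₀ (by positivity)]
      refine rpow_le_of_comparable hb0 hw0 hκ1 (by nlinarith) (hb3.trans ?_) q
      gcongr
  · -- the centres of a packing lie in different stopping cylinders
    refine iSup_le fun s => iSup_le fun hs => iSup_le fun hdisj => ?_
    rw [support_selfAffineMeasure h0 h1] at hs
    have hx : ∀ y ∈ s, ∃ x, baranskiCarpet.proj x = y := fun y hy => hs hy
    choose! x hx using hx
    choose n hn using fun y => exists_initialWord_mem_stopWords (x y) (J + 5)
    have hinj : Set.InjOn (fun y => initialWord (x y) (n y)) s := by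
      intro y hy y' hy' h
      have hlen : n y = n y' := by
        have := congrArg List.length h
        simpa only [length_initialWord] using this
      have hdist := dist_carpet_proj_le (initialWord_eq_iff.1
        (show initialWord (x y) (n y) = initialWord (x y') (n y) from h.trans (by simp only [hlen])))
      have h4 : (1 / 2 : ℝ) ^ depth (initialWord (x y) (n y)) ≤ (1 / 2) ^ (J + 5) :=
        pow_le_pow_of_le_one (by norm_num) (by norm_num) (depth_le_of_mem_stopWords (hn y)).1
      have h5 : 2 * (1 / 2 : ℝ) ^ (J + 5) = (1 / 2) ^ (J + 4) := by rw [pow_succ]; ring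
      rw [hx y hy, hx y' hy'] at hdist
      have hδ0 : 0 < δ := lt_trans (by positivity) hδ1
      by_contra hne
      exact Set.disjoint_left.1 (hdisj hy hy' hne) (Metric.mem_closedBall_self hδ0.le)
        (Metric.mem_closedBall.2 (by linarith))
    calc ∑ y ∈ s, baranskiCarpet.selfAffineMeasure ![u, 1 - u] (Metric.closedBall y δ) ^ q
        ≤ ∑ y ∈ s, ENNReal.ofReal (κ ^ |q| *
            wordWeight (u ^ q) ((1 - u) ^ q) (initialWord (x y) (n y))) := by
          refine Finset.sum_le_sum fun y hy => ?_
          obtain ⟨n₀, hn₀⟩ := exists_initialWord_mem_stopWords (x y) J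
          obtain ⟨b, hb, hb1, hb2, hb3⟩ := exists_measure_closedBall_eq h0 h1 hδ1 hδ2 hn₀ (hn y)
          have hw0 := wordWeight_pos h0 hu' (initialWord (x y) (n y))
          have hb0 : 0 < b := hw0.trans_le hb1
          rw [hx y hy] at hb
          rw [hb, ENNReal.ofReal_rpow_of_pos hb0]
          refine ENNReal.ofReal_le_ofReal ?_
          rw [← wordWeight_rpow h0 hu']
          exact rpow_le_of_comparable hw0 hb0 hκ1 (by nlinarith) (hb2.trans hb3) q
      _ = ENNReal.ofReal (κ ^ |q| * ∑ w ∈ s.image fun y => initialWord (x y) (n y),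
            wordWeight (u ^ q) ((1 - u) ^ q) w) := by
          rw [Finset.sum_image hinj, Finset.mul_sum, ENNReal.ofReal_sum_of_nonneg
            fun y _ => by have := hwpos (initialWord (x y) (n y)); positivity]
      _ ≤ _ := by
          refine ENNReal.ofReal_le_ofReal (mul_le_mul_of_nonneg_left ?_ (by positivity))
          refine Finset.sum_le_sum_of_subset_of_nonneg ?_ fun w _ _ => (hwpos w).le
          intro w hw
          obtain ⟨y, -, rfl⟩ := Finset.mem_image.1 hw
          exact hn y

end Packing

/-! ### From the partition function to the spectrum -/

/-- If the partition function grows like `ρ ^ L` up to a factor `exp (O (√L))`, then the spectrum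
is `log ρ / log 2`. -/
lemma hasLqSpectrum_of_stopSum {u : ℝ} (h0 : 0 < u) (h1 : u < 1) {q t c C D : ℝ}
    (hc : 0 < c) (hC : 0 < C)
    (hlow : ∀ L : ℕ, c * Real.exp (t * Real.log 2 * L - D * √(L + 1)) ≤
      stopSum (u ^ q) ((1 - u) ^ q) L)
    (hup : ∀ L : ℕ, stopSum (u ^ q) ((1 - u) ^ q) L ≤ C * Real.exp (t * Real.log 2 * L)) :
    HasLqSpectrum (baranskiCarpet.selfAffineMeasure ![u, 1 - u]) q t := by
  obtain ⟨K, hK, hpack⟩ := exists_packingSum_bounds h0 h1 q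
  have hlog2 : 0 < Real.log 2 := Real.log_pos one_lt_two
  have hlog2' : Real.log 2 ≤ 1 := (Real.log_le_sub_one_of_pos two_pos).trans (by norm_num)
  -- additive error terms, with `E` absorbing all constants
  set E : ℝ := |Real.log (K⁻¹ * c)| + |Real.log (K * C)| + 10 * |t| with hE
  have hbound : ∀ᶠ δ in 𝓝[>] (0 : ℝ),
      ((t * -Real.log δ - E - |D| * √(2 * -Real.log δ + 1) : ℝ) : EReal) ≤
        ENNReal.log (packingSum (baranskiCarpet.selfAffineMeasure ![u, 1 - u]) q δ) ∧
      ENNReal.log (packingSum (baranskiCarpet.selfAffineMeasure ![u, 1 - u]) q δ) ≤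
        ((t * -Real.log δ + E : ℝ) : EReal) := by
    filter_upwards [Ioo_mem_nhdsGT (show (0 : ℝ) < (1 / 2) ^ 3 by norm_num)] with δ hδ
    obtain ⟨N, hN1, hN2⟩ := exists_nat_pow_near_of_lt_one hδ.1
      (hδ.2.le.trans (by norm_num)) (show (0 : ℝ) < 1 / 2 by norm_num) (by norm_num)
    have hN3 : 3 ≤ N := by
      by_contra! hlt
      have : (1 / 2 : ℝ) ^ 3 ≤ (1 / 2) ^ (N + 1) :=
        pow_le_pow_of_le_one (by norm_num) (by norm_num) (by omega)
      linarith [hδ.2]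
    obtain ⟨J, rfl⟩ := Nat.exists_eq_add_of_le' hN3
    obtain ⟨hp1, hp2⟩ := hpack J δ hN1 hN2
    have hl1 : -Real.log δ ≤ (J + 4) * Real.log 2 := by
      have := Real.log_le_log (by positivity) hN1.le
      rw [Real.log_pow, one_div, Real.log_inv] at this
      push_cast at this
      linarith
    have hl2 : (J + 3) * Real.log 2 ≤ -Real.log δ := by
      have := Real.log_le_log hδ.1 hN2
      rw [Real.log_pow, one_div, Real.log_inv] at this
      push_cast at this
      linarith
    constructor
    · refine le_trans ?_ (ENNReal.log_le_log hp1)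
      have hpos : 0 < K⁻¹ * c * Real.exp (t * Real.log 2 * J - D * √(J + 1)) := by positivity
      refine le_trans ?_ (ENNReal.log_le_log (ENNReal.ofReal_le_ofReal
        (show K⁻¹ * c * Real.exp (t * Real.log 2 * J - D * √(J + 1)) ≤ _ from by
          rw [mul_assoc]
          exact mul_le_mul_of_nonneg_left (hlow J) (by positivity))))
      rw [ENNReal.log_ofReal_of_pos hpos, Real.log_mul (by positivity) (by positivity),
        Real.log_exp]
      refine EReal.coe_le_coe_iff.2 ?_
      have e1 := neg_abs_le (Real.log (K⁻¹ * c))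
      have e2 := abs_nonneg (Real.log (K * C))
      have e3 : t * (-Real.log δ - Real.log 2 * J) ≤ 10 * |t| := by
        have : |(-Real.log δ - Real.log 2 * J)| ≤ 10 := abs_le.2 ⟨by nlinarith, by nlinarith⟩
        calc _ ≤ |t * (-Real.log δ - Real.log 2 * J)| := le_abs_self _
          _ = |t| * |(-Real.log δ - Real.log 2 * J)| := abs_mul _ _
          _ ≤ |t| * 10 := by gcongr
          _ = _ := mul_comm _ _
      have e4 : D * √(J + 1) ≤ |D| * √(2 * -Real.log δ + 1) := by
        have : (J : ℝ) + 1 ≤ 2 * -Real.log δ + 1 := by nlinarith [Real.log_two_gt_d9]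
        calc D * √(J + 1) ≤ |D| * √(J + 1) := by gcongr; exact le_abs_self D
          _ ≤ _ := by gcongr
      linarith
    · refine (ENNReal.log_le_log hp2).trans ?_
      have hpos : 0 < K * C * Real.exp (t * Real.log 2 * (J + 5 : ℕ)) := by positivity
      refine (ENNReal.log_le_log (ENNReal.ofReal_le_ofReal
        (show _ ≤ K * C * Real.exp (t * Real.log 2 * (J + 5 : ℕ)) from by
          rw [mul_assoc]
          exact mul_le_mul_of_nonneg_left (hup (J + 5)) hK.le))).trans ?_
      rw [ENNReal.log_ofReal_of_pos hpos, Real.log_mul (by positivity) (by positivity),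
        Real.log_exp]
      refine EReal.coe_le_coe_iff.2 ?_
      have e1 := le_abs_self (Real.log (K * C))
      have e2 := abs_nonneg (Real.log (K⁻¹ * c))
      push_cast
      have e3 : t * (Real.log 2 * (J + 5) - -Real.log δ) ≤ 10 * |t| := by
        have : |Real.log 2 * (J + 5) - -Real.log δ| ≤ 10 := abs_le.2 ⟨by nlinarith, by nlinarith⟩
        calc _ ≤ |t * (Real.log 2 * (J + 5) - -Real.log δ)| := le_abs_self _
          _ = |t| * |Real.log 2 * (J + 5) - -Real.log δ| := abs_mul _ _
          _ ≤ |t| * 10 := by gcongr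
          _ = _ := mul_comm _ _
      linarith
  clear_value E
  have hl : Tendsto (fun δ : ℝ => -Real.log δ) (𝓝[>] 0) atTop :=
    tendsto_neg_atBot_atTop.comp Real.tendsto_log_nhdsGT_zero
  have hlow' : Tendsto (fun δ : ℝ => (t * -Real.log δ - E - |D| * √(2 * -Real.log δ + 1)) /
      -Real.log δ) (𝓝[>] 0) (𝓝 t) := by
    have hsq : Tendsto (fun x : ℝ => √(2 * x + 1) / x) atTop (𝓝 0) := by
      have h2 : Tendsto (fun x : ℝ => √(2 / x + (1 / x) * (1 / x))) atTop (𝓝 0) := by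
        have h3 : Tendsto (fun x : ℝ => 2 / x + (1 / x) * (1 / x)) atTop (𝓝 (0 + 0 * 0)) :=
          (tendsto_const_nhds.div_atTop tendsto_id).add
            ((tendsto_const_nhds.div_atTop tendsto_id).mul
              (tendsto_const_nhds.div_atTop tendsto_id))
        simpa using h3.sqrt
      refine h2.congr' ?_
      filter_upwards [eventually_gt_atTop 0] with x hx
      rw [show 2 / x + (1 / x) * (1 / x) = (2 * x + 1) / x ^ 2 by field_simp,
        Real.sqrt_div (by positivity), Real.sqrt_sq hx.le]
    have h3 : Tendsto (fun x : ℝ => t - E / x - |D| * (√(2 * x + 1) / x)) atTop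
        (𝓝 (t - 0 - |D| * 0)) :=
      ((tendsto_const_nhds.sub (tendsto_const_nhds.div_atTop tendsto_id))).sub
        (tendsto_const_nhds.mul hsq)
    rw [mul_zero, sub_zero, sub_zero] at h3
    refine (h3.comp hl).congr' ?_
    filter_upwards [hl.eventually_gt_atTop 0] with δ hδ
    simp only [Function.comp_apply]
    rw [sub_div, sub_div, mul_div_cancel_right₀ _ hδ.ne', mul_div_assoc]
  have hup' : Tendsto (fun δ : ℝ => (t * -Real.log δ + E) / -Real.log δ) (𝓝[>] 0) (𝓝 t) := by
    have h3 : Tendsto (fun x : ℝ => t + E / x) atTop (𝓝 (t + 0)) :=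
      tendsto_const_nhds.add (tendsto_const_nhds.div_atTop tendsto_id)
    rw [add_zero] at h3
    refine (h3.comp hl).congr' ?_
    filter_upwards [hl.eventually_gt_atTop 0] with δ hδ
    simp only [Function.comp_apply]
    rw [add_div, mul_div_cancel_right₀ _ hδ.ne']
  refine tendsto_of_tendsto_of_tendsto_of_le_of_le'
    ((continuous_coe_real_ereal.tendsto t).comp hlow')
    ((continuous_coe_real_ereal.tendsto t).comp hup') ?_ ?_
  · filter_upwards [hbound, hl.eventually_gt_atTop 0] with δ hδ hpos
    rw [Function.comp_apply, EReal.coe_div]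
    exact EReal.div_le_div_right_of_nonneg (EReal.coe_nonneg.2 hpos.le) hδ.1
  · filter_upwards [hbound, hl.eventually_gt_atTop 0] with δ hδ hpos
    rw [Function.comp_apply, EReal.coe_div]
    exact EReal.div_le_div_right_of_nonneg (EReal.coe_nonneg.2 hpos.le) hδ.2

/-- Spectrum in the regime where the partition function is carried by words with at least as many
letters of weight `A` as letters of weight `B`. -/
lemma hasLqSpectrum_of_le {u : ℝ} (h0 : 0 < u) (h1 : u < 1) {q A B t : ℝ} (hB : 0 < B)
    (hAB : B ≤ A) (hle : B ≤ 2 * A ^ 2)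
    (hS : ∀ L, stopSum (u ^ q) ((1 - u) ^ q) L = stopSum A B L)
    (ht : A * (1 / 2) ^ t + B * (1 / 4) ^ t = 1) :
    HasLqSpectrum (baranskiCarpet.selfAffineMeasure ![u, 1 - u]) q t := by
  set z : ℝ := (1 / 2) ^ t with hz
  have hz0 : 0 < z := Real.rpow_pos_of_pos (by norm_num) _
  have hA : 0 < A := hB.trans_le hAB
  have hz4 : (1 / 4 : ℝ) ^ t = z ^ 2 := by
    rw [hz, ← Real.rpow_natCast, ← Real.rpow_mul (by norm_num), mul_comm, Real.rpow_mul (by norm_num)]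
    norm_num
  rw [hz4] at ht
  have hexp : ∀ L : ℕ, Real.exp (t * Real.log 2 * L) = z⁻¹ ^ L := by
    intro L
    rw [hz, one_div, Real.inv_rpow zero_le_two, inv_inv, Real.rpow_def_of_pos two_pos,
      ← Real.exp_nat_mul]
    ring_nf
  -- otherwise `A z < 1 / 2 < B z ^ 2`, contrary to `B ≤ 2 A ^ 2`
  have hBz : B * z ≤ A := by
    by_contra! hlt
    have h2 : A * z < B * z ^ 2 := by nlinarith
    have h3 : 2 * A * z < 1 := by linarith
    have h4 : (2 * A * z) ^ 2 < 1 := by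
      have : 0 < 2 * A * z := by positivity
      nlinarith
    have h5 : B * z ^ 2 ≤ 2 * A ^ 2 * z ^ 2 := by gcongr
    nlinarith
  refine hasLqSpectrum_of_stopSum (D := 0) h0 h1 (c := (2 * (1 + z))⁻¹) (C := 2 * (1 + z⁻¹))
    (by positivity) (by positivity) (fun L => ?_) fun L => ?_
  · rw [zero_mul, sub_zero, hexp, hS]
    exact le_stopSum hA hB hz0 ht hBz L
  · rw [hexp, hS]
    exact stopSum_le hB hAB hz0 ht L

/-- Spectrum in the regime where the partition function is carried by words with equally many
letters of both kinds. -/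
lemma hasLqSpectrum_of_ge {u : ℝ} (h0 : 0 < u) (h1 : u < 1) {q : ℝ}
    (hAB : (1 - u) ^ q ≤ u ^ q) (hge : 2 * (u ^ q) ^ 2 ≤ (1 - u) ^ q) :
    HasLqSpectrum (baranskiCarpet.selfAffineMeasure ![u, 1 - u]) q
      (2 / 3 + Real.log (u * (1 - u)) / (3 * Real.log 2) * q) := by
  set t : ℝ := 2 / 3 + Real.log (u * (1 - u)) / (3 * Real.log 2) * q with ht
  have hu' : 0 < 1 - u := by linarith
  have hlog2 : 0 < Real.log 2 := Real.log_pos one_lt_two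
  set A : ℝ := u ^ q with hA
  set B : ℝ := (1 - u) ^ q with hB
  have hA0 : 0 < A := Real.rpow_pos_of_pos h0 q
  have hB0 : 0 < B := Real.rpow_pos_of_pos hu' q
  set ρ : ℝ := Real.exp (t * Real.log 2) with hρ
  have hρ0 : 0 < ρ := Real.exp_pos _
  have hρ3 : 4 * A * B = ρ ^ 3 := by
    have e1 : A * B = Real.exp (Real.log (u * (1 - u)) * q) := by
      rw [hA, hB, ← Real.mul_rpow h0.le hu'.le, Real.rpow_def_of_pos (by positivity)]
    have e2 : (4 : ℝ) = Real.exp (2 * Real.log 2) := by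
      rw [two_mul, Real.exp_add, Real.exp_log two_pos]; norm_num
    rw [mul_assoc, e1, e2, ← Real.exp_add, hρ, ← Real.exp_nat_mul, ht]
    congr 1
    push_cast
    field_simp
  have hAρ : 2 * A ≤ ρ := by
    refine le_of_pow_le_pow_left₀ (n := 3) (by norm_num) hρ0.le ?_
    rw [← hρ3]
    nlinarith
  have hBρ : 2 * B ≤ ρ := by linarith
  have hexp : ∀ L : ℕ, Real.exp (t * Real.log 2 * L) = ρ ^ L := fun L => by
    rw [hρ, ← Real.exp_nat_mul]; ring_nf
  refine hasLqSpectrum_of_stopSum (D := -2 * Real.log (2 * B / ρ)) h0 h1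
    (c := 3 / 4 * (1 + ρ⁻¹)⁻¹) (C := 1 + ρ)
    (by positivity) (by positivity) (fun L => ?_) fun L => ?_
  · have hθρ : 2 * B / ρ * ρ = 2 * B := by field_simp
    refine le_trans (le_of_eq ?_) (le_stopSum_of_critical (θ := 2 * B / ρ) hA0 hρ0 hρ3
      (by positivity) ((div_le_one hρ0).2 hBρ) (by rw [hθρ]; linarith) hθρ.le L)
    rw [sub_eq_add_neg, Real.exp_add, hexp, Real.rpow_def_of_pos (by positivity)]
    ring_nf
  · rw [hexp]
    exact stopSum_le_of_critical hA0 hB0 hρ0 hρ3 hAρ hBρ L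

/-! ### The closed form exponent -/

/-- The closed form exponent `T_v^σ (q)` for the weights `(v, 1 - v)`. -/
noncomputable def closedExponent (v q : ℝ) : ℝ :=
  -1 / Real.log 2 * (q * Real.log (v / (1 - v)) +
    Real.log (1 / 2 * √(1 + 4 * ((1 - v) / v ^ 2) ^ q) - 1 / 2))

lemma one_lt_sqrt_one_add {x : ℝ} (hx : 0 < x) : 1 < √(1 + 4 * x) := by
  rw [Real.lt_sqrt zero_le_one]; linarith

lemma closedExponent_spec {v : ℝ} (h0 : 0 < v) (h1 : v < 1) (q : ℝ) :
    v ^ q * (1 / 2) ^ closedExponent v q + (1 - v) ^ q * (1 / 4) ^ closedExponent v q = 1 := by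
  have hv' : 0 < 1 - v := by linarith
  have hlog2 : 0 < Real.log 2 := Real.log_pos one_lt_two
  have hx : 0 < ((1 - v) / v ^ 2) ^ q := Real.rpow_pos_of_pos (by positivity) q
  have hg := one_lt_sqrt_one_add hx
  have hg2 := Real.sq_sqrt (show 0 ≤ 1 + 4 * ((1 - v) / v ^ 2) ^ q by positivity)
  have hx' : ((1 - v) / v ^ 2) ^ q = (1 - v) ^ q / (v ^ q) ^ 2 := by
    rw [Real.div_rpow hv'.le (by positivity), ← Real.rpow_natCast, ← Real.rpow_mul h0.le,
      ← Real.rpow_natCast (v ^ q), ← Real.rpow_mul h0.le, mul_comm q]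
  have hz : (1 / 2 : ℝ) ^ closedExponent v q = (v / (1 - v)) ^ q *
      (1 / 2 * √(1 + 4 * ((1 - v) / v ^ 2) ^ q) - 1 / 2) := by
    rw [Real.rpow_def_of_pos (by norm_num), one_div, Real.log_inv, closedExponent]
    have : -Real.log 2 * (-1 / Real.log 2 * (q * Real.log (v / (1 - v)) +
        Real.log (1 / 2 * √(1 + 4 * ((1 - v) / v ^ 2) ^ q) - 1 / 2))) =
        Real.log (v / (1 - v)) * q +
          Real.log (1 / 2 * √(1 + 4 * ((1 - v) / v ^ 2) ^ q) - 1 / 2) := by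
      field_simp
    rw [← one_div, this, Real.exp_add, Real.exp_log (by linarith),
      ← Real.rpow_def_of_pos (by positivity)]
  have hz4 : (1 / 4 : ℝ) ^ closedExponent v q = ((1 / 2 : ℝ) ^ closedExponent v q) ^ 2 := by
    rw [← Real.rpow_natCast, ← Real.rpow_mul (by norm_num), mul_comm, Real.rpow_mul (by norm_num)]
    norm_num
  rw [hz4, hz, Real.div_rpow h0.le hv'.le]
  set g := √(1 + 4 * ((1 - v) / v ^ 2) ^ q)
  rw [hx'] at hg2
  have hA : 0 < v ^ q := Real.rpow_pos_of_pos h0 q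
  have hB : 0 < (1 - v) ^ q := Real.rpow_pos_of_pos hv' q
  set A := v ^ q
  set B := (1 - v) ^ q
  have : A * (A / B * (1 / 2 * g - 1 / 2)) + B * (A / B * (1 / 2 * g - 1 / 2)) ^ 2 =
      A ^ 2 / (4 * B) * (g ^ 2 - 1) := by
    field_simp
    ring
  rw [this, hg2]
  field_simp
  ring

lemma strictAnti_two_rpow {A B a b : ℝ} (hA : 0 < A) (hB : 0 < B) (ha : 0 < a) (ha1 : a < 1)
    (hb : 0 < b) (hb1 : b < 1) : StrictAnti fun t : ℝ => A * a ^ t + B * b ^ t := by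
  intro x y hxy
  have h1 := Real.rpow_lt_rpow_of_exponent_gt ha ha1 hxy
  have h2 := Real.rpow_lt_rpow_of_exponent_gt hb hb1 hxy
  exact add_lt_add (mul_lt_mul_of_pos_left h1 hA) (mul_lt_mul_of_pos_left h2 hB)

/-- Both equations of the recursive system have the same solution: once the first one is solved by
`T`, the second one holds with increment `0`, and it determines the increment. -/
lemma exponent_system_iff {A B T : ℝ} (hA : 0 < A) (hB : 0 < B)
    (hT : A * (1 / 2) ^ T + B * (1 / 4) ^ T = 1) (V : Fin 3 → ℝ) :
    (V 0 = 0 ∧ A * (1 / 2) ^ (V 1 - V 0) + B * (1 / 4) ^ (V 1 - V 0) = 1 ∧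
      A * ((1 / 2) ^ (V 1 - V 0) * (1 / 4) ^ (V 2 - V 1)) +
        B * ((1 / 4) ^ (V 1 - V 0) * (1 / 2) ^ (V 2 - V 1)) = 1) ↔ V = ![0, T, T] := by
  have hp : ∀ x : ℝ, 0 < x → x ^ T > 0 := fun x hx => Real.rpow_pos_of_pos hx T
  constructor
  · rintro ⟨h0, h1, h2⟩
    rw [h0, sub_zero] at h1 h2
    have e1 : V 1 = T := (strictAnti_two_rpow hA hB (by norm_num : (0 : ℝ) < 1 / 2) (by norm_num)
      (by norm_num : (0 : ℝ) < 1 / 4) (by norm_num)).injective (h1.trans hT.symm)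
    rw [e1, ← mul_assoc, ← mul_assoc] at h2
    have e2 : V 2 - T = 0 := (strictAnti_two_rpow (mul_pos hA (hp _ (by norm_num)))
      (mul_pos hB (hp _ (by norm_num))) (by norm_num : (0 : ℝ) < 1 / 4) (by norm_num)
      (by norm_num : (0 : ℝ) < 1 / 2) (by norm_num)).injective
        (h2.trans (by simpa using hT.symm))
    ext i
    fin_cases i
    · exact h0
    · exact e1
    · exact sub_eq_zero.1 e2
  · rintro rfl
    simpa using hT

lemma carpet_not_overlapExactly (σ : Equiv.Perm (Fin 2)) {n : ℕ} (hn : 0 < n) {i j : Fin 2}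
    (hij : i ≠ j) : ¬ baranskiCarpet.OverlapExactly σ n i j := by
  intro h
  have := h 0 (fun k => by simp) 0 hn
  simp only [DiagonalIFS.map, PiLp.zero_apply, mul_zero, zero_add] at this
  generalize σ 0 = c at this
  fin_cases c <;> fin_cases i <;> fin_cases j <;>
    first | exact absurd rfl hij | norm_num [baranskiCarpet] at this

lemma carpet_overlapExactly_iff (σ : Equiv.Perm (Fin 2)) {n : ℕ} (hn : 0 < n) {i j : Fin 2} :
    baranskiCarpet.OverlapExactly σ n i j ↔ i = j := by
  constructor
  · intro h
    by_contra hij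
    exact carpet_not_overlapExactly σ hn hij h
  · rintro rfl x _ l _
    rfl

lemma carpet_isExponentVector_iff (μ : Fin 2 → ℝ) (σ : Equiv.Perm (Fin 2)) (q : ℝ)
    (V : Fin 3 → ℝ) :
    baranskiCarpet.IsExponentVector μ σ q V ↔ V 0 = 0 ∧
      ∑ i, μ i ^ q * baranskiCarpet.a i (σ 0) ^ (V 1 - V 0) = 1 ∧
      ∑ i, μ i ^ q * (baranskiCarpet.a i (σ 0) ^ (V 1 - V 0) *
        baranskiCarpet.a i (σ 1) ^ (V 2 - V 1)) = 1 := by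
  have hindex : ∀ n : ℕ, baranskiCarpet.index σ (n + 1) = Finset.univ := by
    intro n
    ext j
    simp only [DiagonalIFS.index, Finset.mem_filter, Finset.mem_univ, true_and, iff_true]
    exact fun i hi => carpet_not_overlapExactly σ n.succ_pos hi.ne
  have hweight : ∀ (n : ℕ) i, baranskiCarpet.projWeight μ σ (n + 1) i = μ i := by
    intro n i
    simp [DiagonalIFS.projWeight, carpet_overlapExactly_iff σ n.succ_pos, Finset.filter_eq]
  have hI0 : (Finset.Iic (0 : Fin 2)) = {0} := rfl
  have hI1 : (Finset.Iic (1 : Fin 2)) = {0, 1} := rfl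
  simp only [DiagonalIFS.IsExponentVector, hindex, hweight, abs_of_pos (carpet_a_pos _ _),
    Fin.forall_fin_two, hI0, hI1, Finset.prod_singleton, Finset.prod_pair zero_ne_one]
  rfl

/-! ### Derivatives of the closed form exponent -/

/-- The derivative of `closedExponent v`. -/
noncomputable def closedExponentDeriv (v q : ℝ) : ℝ :=
  -1 / Real.log 2 * (Real.log (v / (1 - v)) +
    1 / 2 * (1 + (√(1 + 4 * ((1 - v) / v ^ 2) ^ q))⁻¹) * Real.log ((1 - v) / v ^ 2))

lemma hasDerivAt_sqrt_one_add_rpow {r : ℝ} (hr : 0 < r) (q : ℝ) :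
    HasDerivAt (fun q => √(1 + 4 * r ^ q)) (2 * r ^ q * Real.log r / √(1 + 4 * r ^ q)) q := by
  have hx : 0 < r ^ q := Real.rpow_pos_of_pos hr q
  have h1 : HasDerivAt (fun q => 1 + 4 * r ^ q) (4 * (r ^ q * Real.log r)) q :=
    ((Real.hasStrictDerivAt_const_rpow hr q).hasDerivAt.const_mul 4).const_add 1
  convert h1.sqrt (by positivity) using 1
  field_simp
  ring

lemma hasDerivAt_closedExponent {v : ℝ} (h0 : 0 < v) (h1 : v < 1) (q : ℝ) :
    HasDerivAt (closedExponent v) (closedExponentDeriv v q) q := by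
  have hr : 0 < (1 - v) / v ^ 2 := div_pos (by linarith) (by positivity)
  have hx : 0 < ((1 - v) / v ^ 2) ^ q := Real.rpow_pos_of_pos hr q
  have hg := one_lt_sqrt_one_add hx
  have hg2 := Real.sq_sqrt (show 0 ≤ 1 + 4 * ((1 - v) / v ^ 2) ^ q by positivity)
  have hd := (((hasDerivAt_id q).mul_const (Real.log (v / (1 - v)))).add
    ((((hasDerivAt_sqrt_one_add_rpow hr q).const_mul (1 / 2)).sub_const (1 / 2)).log
      (by linarith))).const_mul (-1 / Real.log 2)
  refine HasDerivAt.congr_deriv hd ?_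
  rw [closedExponentDeriv]
  set g := √(1 + 4 * ((1 - v) / v ^ 2) ^ q)
  set x := ((1 - v) / v ^ 2) ^ q
  congr 1
  rw [one_mul]
  congr 1
  have hx4 : x = (g ^ 2 - 1) / 4 := by linarith
  have hg1 : g - 1 ≠ 0 := by linarith
  have hg0 : g ≠ 0 := by linarith
  rw [hx4, show 1 / 2 * g - 1 / 2 = (g - 1) / 2 by ring]
  field_simp
  ring

lemma exists_hasDerivAt_closedExponentDeriv {v : ℝ} (h0 : 0 < v) (h1 : v < 1)
    (hr1 : 1 < (1 - v) / v ^ 2) (q : ℝ) :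
    ∃ d, 0 < d ∧ HasDerivAt (closedExponentDeriv v) d q := by
  have hr : 0 < (1 - v) / v ^ 2 := by linarith
  have hx : 0 < ((1 - v) / v ^ 2) ^ q := Real.rpow_pos_of_pos hr q
  have hg := one_lt_sqrt_one_add hx
  have hg0 : √(1 + 4 * ((1 - v) / v ^ 2) ^ q) ≠ 0 := by linarith
  have hlog := Real.log_pos hr1
  have hlog2 : 0 < Real.log 2 := Real.log_pos one_lt_two
  have hd := ((((((hasDerivAt_sqrt_one_add_rpow hr q).inv hg0).const_add 1).const_mul
    (1 / 2)).mul_const (Real.log ((1 - v) / v ^ 2))).const_add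
      (Real.log (v / (1 - v)))).const_mul (-1 / Real.log 2)
  refine ⟨_, ?_, hd⟩
  have : 0 < 2 * ((1 - v) / v ^ 2) ^ q * Real.log ((1 - v) / v ^ 2) /
      √(1 + 4 * ((1 - v) / v ^ 2) ^ q) / √(1 + 4 * ((1 - v) / v ^ 2) ^ q) ^ 2 *
        Real.log ((1 - v) / v ^ 2) / (2 * Real.log 2) := by positivity
  refine this.trans_eq ?_
  field_simp

/-- A function that follows `f` up to `a` and continues affinely along the tangent of `f` at `a` is
differentiable near `a`, but its derivative has a corner at `a` if `f'' (a) ≠ 0`. -/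
lemma differentiable_of_tangent_extension {T f f' : ℝ → ℝ} {a b m d : ℝ} (hb : b < a)
    (hf : ∀ x, HasDerivAt f (f' x) x) (hf' : HasDerivAt f' d a) (hd : d ≠ 0) (hm : f' a = m)
    (hl : ∀ x, b < x → x ≤ a → T x = f x) (hr : ∀ x, a < x → T x = f a + m * (x - a)) :
    (∀ᶠ x in 𝓝 a, DifferentiableAt ℝ T x) ∧ ¬ DifferentiableAt ℝ (deriv T) a := by
  have hline : ∀ x, HasDerivAt (fun x => f a + m * (x - a)) m x := fun x => by
    simpa using (((hasDerivAt_id x).sub_const a).const_mul m).const_add (f a)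
  have hleft : ∀ x, b < x → x < a → HasDerivAt T (f' x) x := fun x h1 h2 =>
    (hf x).congr_of_eventuallyEq (by
      filter_upwards [Ioo_mem_nhds h1 h2] with y hy using hl y hy.1 hy.2.le)
  have hright : ∀ x, a < x → HasDerivAt T m x := fun x h1 =>
    (hline x).congr_of_eventuallyEq (by
      filter_upwards [Ioi_mem_nhds h1] with y hy using hr y hy)
  have hmid : HasDerivAt T m a := by
    rw [← hasDerivWithinAt_univ, ← Iic_union_Ici (a := a)]
    refine HasDerivWithinAt.union ?_ ?_
    · refine ((hf a).congr_deriv hm).hasDerivWithinAt.congr_of_eventuallyEq ?_ (hl a hb le_rfl)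
      filter_upwards [self_mem_nhdsWithin, mem_nhdsWithin_of_mem_nhds (Ioi_mem_nhds hb)] with y h1 h2
        using hl y h2 h1
    · refine (hline a).hasDerivWithinAt.congr (fun y hy => ?_) (by simp [hl a hb le_rfl])
      rcases (mem_Ici.1 hy).eq_or_lt with rfl | hlt
      · simp [hl a hb le_rfl]
      · exact hr y hlt
  refine ⟨?_, fun hdiff => hd ?_⟩
  · filter_upwards [Ioi_mem_nhds hb] with x hx
    rcases lt_trichotomy x a with h | rfl | h
    · exact (hleft x hx h).differentiableAt
    · exact hmid.differentiableAt
    · exact (hright x h).differentiableAt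
  · have hT := hdiff.hasDerivAt
    have e1 : deriv (deriv T) a = d := by
      refine (uniqueDiffWithinAt_Iic a).eq_deriv _ hT.hasDerivWithinAt
        (hf'.hasDerivWithinAt.congr_of_eventuallyEq ?_ (by rw [hmid.deriv, hm]))
      filter_upwards [self_mem_nhdsWithin, mem_nhdsWithin_of_mem_nhds (Ioi_mem_nhds hb)] with y h1 h2
      rcases (mem_Iic.1 h1).eq_or_lt with rfl | hlt
      · rw [hmid.deriv, hm]
      · exact (hleft y h2 hlt).deriv
    have e2 : deriv (deriv T) a = 0 := by
      refine (uniqueDiffWithinAt_Ici a).eq_deriv _ hT.hasDerivWithinAt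
        ((hasDerivAt_const a m).hasDerivWithinAt.congr (fun y hy => ?_) hmid.deriv)
      rcases (mem_Ici.1 hy).eq_or_lt with rfl | hlt
      · exact hmid.deriv
      · exact (hright y hlt).deriv
    exact e1.symm.trans e2

/-! ### The spectrum of the carpet -/

/-- `σ` is the ordering `(1, 2)` of the coordinates (the identity) and `ω` is the ordering `(2, 1)`
(the swap). The vectors `![0, Tσ q, Tσ q]` and `![0, Tω q, Tω q]` are the unique exponent vectors
of the two orderings, and `T` is the `L^q` spectrum. Differentiability in a neighbourhood of the transition point
is stated so that non-differentiability of `deriv T` there has its usual meaning. -/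
theorem mainTheorem9 (u : ℝ) (hu : 1 / 2 ≤ u) (hu1 : u < 1)
    (s : ℝ) (hs : (1 / 2 : ℝ) ^ s + (1 / 4 : ℝ) ^ s = 1) :
    ∃ T Tσ Tω : ℝ → ℝ,
      (∀ q : ℝ, HasLqSpectrum (baranskiCarpet.selfAffineMeasure ![u, 1 - u]) q (T q)) ∧
      (∀ (q : ℝ) (V : Fin 3 → ℝ),
        baranskiCarpet.IsExponentVector ![u, 1 - u] (Equiv.refl (Fin 2)) q V ↔
          V = ![0, Tσ q, Tσ q]) ∧
      (∀ (q : ℝ) (V : Fin 3 → ℝ),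
        baranskiCarpet.IsExponentVector ![u, 1 - u] (Equiv.swap (0 : Fin 2) 1) q V ↔
          V = ![0, Tω q, Tω q]) ∧
      (∀ q : ℝ, Tσ q = -1 / Real.log 2 * (q * Real.log (u / (1 - u)) +
        Real.log (1 / 2 * √(1 + 4 * ((1 - u) / u ^ 2) ^ q) - 1 / 2))) ∧
      (∀ q : ℝ, Tω q = -1 / Real.log 2 * (q * Real.log ((1 - u) / u) +
        Real.log (1 / 2 * √(1 + 4 * (u / (1 - u) ^ 2) ^ q) - 1 / 2))) ∧
      (∀ q : ℝ, q ≤ 0 → T q = Tω q) ∧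
      (u < (1 / 2 : ℝ) ^ s →
        (∀ q : ℝ, 0 < q → q ≤ Real.log 2 / Real.log ((1 - u) / u ^ 2) → T q = Tσ q) ∧
        (∀ q : ℝ, Real.log 2 / Real.log ((1 - u) / u ^ 2) < q →
          T q = 2 / 3 + Real.log (u * (1 - u)) / (3 * Real.log 2) * q) ∧
        (∀ᶠ q in 𝓝 (Real.log 2 / Real.log ((1 - u) / u ^ 2)), DifferentiableAt ℝ T q) ∧
        ¬ DifferentiableAt ℝ (deriv T) (Real.log 2 / Real.log ((1 - u) / u ^ 2))) ∧
      ((1 / 2 : ℝ) ^ s ≤ u → ∀ q : ℝ, 0 < q → T q = Tσ q) := by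
  have h0 : 0 < u := by linarith
  have hu' : 0 < 1 - u := by linarith
  have hlog2 : 0 < Real.log 2 := Real.log_pos one_lt_two
  have hr : 0 < (1 - u) / u ^ 2 := by positivity
  have hA : ∀ q : ℝ, 0 < u ^ q := fun q => Real.rpow_pos_of_pos h0 q
  have hB : ∀ q : ℝ, 0 < (1 - u) ^ q := fun q => Real.rpow_pos_of_pos hu' q
  have hrq : ∀ q : ℝ, ((1 - u) / u ^ 2) ^ q = (1 - u) ^ q / (u ^ q) ^ 2 := fun q => by
    rw [Real.div_rpow hu'.le (by positivity), ← Real.rpow_natCast, ← Real.rpow_mul h0.le,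
      ← Real.rpow_natCast (u ^ q), ← Real.rpow_mul h0.le, mul_comm q]
  have hσ := closedExponent_spec h0 hu1
  have hω : ∀ q : ℝ, (1 - u) ^ q * (1 / 2) ^ closedExponent (1 - u) q +
      u ^ q * (1 / 4) ^ closedExponent (1 - u) q = 1 := fun q => by
    have := closedExponent_spec hu' (by linarith) q
    rwa [sub_sub_cancel] at this
  -- `(1 / 2) ^ s` is the positive root of `x + x ^ 2 = 1`
  have hgold : u < (1 / 2 : ℝ) ^ s ↔ 1 < (1 - u) / u ^ 2 := by
    have hs4 : (1 / 4 : ℝ) ^ s = ((1 / 2 : ℝ) ^ s) ^ 2 := by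
      rw [← Real.rpow_natCast, ← Real.rpow_mul (by norm_num), mul_comm,
        Real.rpow_mul (by norm_num)]
      norm_num
    rw [hs4] at hs
    have hs0 : (0 : ℝ) < (1 / 2 : ℝ) ^ s := Real.rpow_pos_of_pos (by norm_num) s
    rw [one_lt_div (by positivity)]
    constructor <;> intro h <;> nlinarith
  set lin : ℝ → ℝ := fun q => 2 / 3 + Real.log (u * (1 - u)) / (3 * Real.log 2) * q with hlin
  set T : ℝ → ℝ := fun q => if q ≤ 0 then closedExponent (1 - u) q else
    if ((1 - u) / u ^ 2) ^ q ≤ 2 then closedExponent u q else lin q with hT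
  -- the threshold `q̂` when the two regimes both occur
  have hthr : 1 < (1 - u) / u ^ 2 → ∀ q : ℝ, ((1 - u) / u ^ 2) ^ q ≤ 2 ↔
      q ≤ Real.log 2 / Real.log ((1 - u) / u ^ 2) := fun h q => by
    rw [le_div_iff₀ (Real.log_pos h), ← Real.log_rpow hr,
      Real.log_le_log_iff (Real.rpow_pos_of_pos hr q) two_pos]
  have hqhat : 1 < (1 - u) / u ^ 2 → 0 < Real.log 2 / Real.log ((1 - u) / u ^ 2) := fun h =>
    div_pos hlog2 (Real.log_pos h)
  have hTσ : 1 < (1 - u) / u ^ 2 → ∀ q : ℝ, 0 < q →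
      q ≤ Real.log 2 / Real.log ((1 - u) / u ^ 2) → T q = closedExponent u q := fun h q hq hq' => by
    rw [hT]
    simp only
    rw [if_neg (not_le.2 hq), if_pos ((hthr h q).2 hq')]
  have hTlin : 1 < (1 - u) / u ^ 2 → ∀ q : ℝ,
      Real.log 2 / Real.log ((1 - u) / u ^ 2) < q → T q = lin q := fun h q hq => by
    rw [hT]
    simp only
    rw [if_neg (not_le.2 ((hqhat h).trans hq)), if_neg fun h2 => not_lt.2 ((hthr h q).1 h2) hq]
  refine ⟨T, closedExponent u, closedExponent (1 - u), fun q => ?_, fun q V => ?_, fun q V => ?_,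
    fun q => rfl, fun q => by rw [closedExponent, sub_sub_cancel], fun q hq => if_pos hq,
    fun hus => ?_, fun hus q hq => ?_⟩
  · rw [hT]
    simp only
    split_ifs with hq hle
    · have hAB : u ^ q ≤ (1 - u) ^ q := Real.rpow_le_rpow_of_nonpos hu' (by linarith) hq
      have hone : 1 ≤ (1 - u) ^ q := Real.one_le_rpow_of_pos_of_le_one_of_nonpos hu' (by linarith) hq
      exact hasLqSpectrum_of_le h0 hu1 (hA q) hAB (by nlinarith) (fun L => stopSum_comm _ _ L) (hω q)
    · have hAB : (1 - u) ^ q ≤ u ^ q := Real.rpow_le_rpow hu'.le (by linarith) (not_le.1 hq).le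
      rw [hrq, div_le_iff₀ (pow_pos (hA q) 2)] at hle
      exact hasLqSpectrum_of_le h0 hu1 (hB q) hAB hle (fun L => rfl) (hσ q)
    · have hAB : (1 - u) ^ q ≤ u ^ q := Real.rpow_le_rpow hu'.le (by linarith) (not_le.1 hq).le
      rw [hrq, div_le_iff₀ (pow_pos (hA q) 2), not_le] at hle
      exact hasLqSpectrum_of_ge h0 hu1 hAB hle.le
  · rw [carpet_isExponentVector_iff, ← exponent_system_iff (hA q) (hB q) (hσ q) V,
      Fin.sum_univ_two, Fin.sum_univ_two]
    rfl
  · rw [carpet_isExponentVector_iff, ← exponent_system_iff (hB q) (hA q) (hω q) V,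
      Fin.sum_univ_two, Fin.sum_univ_two, add_comm, add_comm (((![u, 1 - u] : Fin 2 → ℝ) 0) ^ q * _)]
    rfl
  · have hr1 := hgold.1 hus
    refine ⟨hTσ hr1, hTlin hr1, ?_⟩
    have hlogr := Real.log_pos hr1
    set a := Real.log 2 / Real.log ((1 - u) / u ^ 2) with ha
    -- `√(1 + 4 r ^ q)` equals `3` at the threshold
    have hra : ((1 - u) / u ^ 2) ^ a = 2 := by
      rw [Real.rpow_def_of_pos hr, ha, mul_div_cancel₀ _ hlogr.ne', Real.exp_log two_pos]
    have hsqrt : √(1 + 4 * ((1 - u) / u ^ 2) ^ a) = 3 := by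
      rw [hra, show (1 + 4 * 2 : ℝ) = 3 ^ 2 by norm_num, Real.sqrt_sq (by norm_num)]
    have hlr : Real.log ((1 - u) / u ^ 2) = Real.log (1 - u) - 2 * Real.log u := by
      rw [Real.log_div hu'.ne' (by positivity), Real.log_pow]
      norm_num
    have hld : Real.log (u / (1 - u)) = Real.log u - Real.log (1 - u) :=
      Real.log_div h0.ne' hu'.ne'
    have hlm : Real.log (u * (1 - u)) = Real.log u + Real.log (1 - u) :=
      Real.log_mul h0.ne' hu'.ne'
    have hval : closedExponent u a = lin a := by
      have h2 : a * (Real.log (1 - u) - 2 * Real.log u) = Real.log 2 := by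
        rw [← hlr, ha, div_mul_cancel₀ _ hlogr.ne']
      rw [closedExponent, hsqrt, hlin]
      norm_num
      rw [hld, hlm]
      field_simp
      linarith
    have hslope : closedExponentDeriv u a = Real.log (u * (1 - u)) / (3 * Real.log 2) := by
      rw [closedExponentDeriv, hsqrt, hld, hlr, hlm]
      field_simp
      ring
    obtain ⟨d, hd, hd'⟩ := exists_hasDerivAt_closedExponentDeriv h0 hu1 hr1 a
    refine differentiable_of_tangent_extension (hqhat hr1) (hasDerivAt_closedExponent h0 hu1) hd' hd.ne'
      hslope (hTσ hr1) fun q hq => ?_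
    rw [hTlin hr1 q hq, hval]
    simp only [hlin]
    ring
  · have hr1 : (1 - u) / u ^ 2 ≤ 1 := not_lt.1 fun h => not_lt.2 hus (hgold.2 h)
    rw [hT]
    simp only
    rw [if_neg (not_le.2 hq), if_pos]
    exact (Real.rpow_le_one hr.le hr1 hq.le).trans one_le_two
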